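/- For $d\ge 1$ let $\mathcal P_d(\mathbb R)$ be the set of monic polynomials of degree $d$ with real coefficients and only real roots. Write $p\in\mathcal P_d(\mathbb R)$ as $p(x)=\sum_{k=0}^d x^{d-k}(-1)^k\binom dk e_k(p)$. The finite-free additive convolution of $p,q\in\mathcal P_d(\mathbb R)$ is $$[p\boxplus_d q](x)=\sum_{k=0}^d x^{d-k}(-1)^k\binom dk\Big[\sum_{i=0}^k\binom ki e_i(p)\,e_{k-i}(q)\Big].$$ For $p\in\mathcal P_d(\mathbb R)$ let $\mu_p$ be its root distribution, the probability measure putting mass $1/d$ at each root, counted with multiplicity. For a measure $\mu$ on $\mathbb R$ write $m_n(\mu)=\int t^n\,d\mu(t)$. Let $\mu$ be a probability measure on $\mathbb R$ with finite moments of all orders and $\mu':\mathbb R[x]\to\mathbb R$ a linear functional. A sequence $\mathfrak p=(p_d)_{d\ge1}$ with $p_d\in\mathcal P_d(\mathbb R)$ has infinitesimal distribution $(\mu,\mu')$ if for every $n\ge0$ $$m_n(\mu_{p_d})\to m_n(\mu)\quad\text{and}\quad d\,\big(m_n(\mu_{p_d})-m_n(\mu)\big)\to\mu'(x^n)\qquad(d\to\infty);$$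 in particular $\mu'(1)=0$. Let $NC(n)$ be the set of non-crossing partitions of $\{1,\dots,n\}$. The free cumulants $(r_n(\mu))_{n\ge1}$ and the infinitesimal free cumulants $(r'_n(\mu,\mu'))_{n\ge1}$ are defined recursively by $$m_n(\mu)=\sum_{\pi\in NC(n)}\prod_{V\in\pi}r_{|V|}(\mu),\qquad \mu'(x^n)=\sum_{\pi\in NC(n)}\sum_{V\in\pi}r'_{|V|}(\mu,\mu')\prod_{W\in\pi,\,W\ne V}r_{|W|}(\mu)\qquad(n\ge1).$$ A pair $(\gamma,\gamma')$, with $\gamma$ a probability measure on $\mathbb R$ with finite moments of all orders and $\gamma':\mathbb R[x]\to\mathbb R$ linear with $\gamma'(1)=0$, is an infinitesimal free additive convolution $(\mu,\mu')\boxplus_B(\nu,\nu')$ if $r_n(\gamma)=r_n(\mu)+r_n(\nu)$ (that is, $\gamma=\mu\boxplus\nu$) and $r'_n(\gamma,\gamma')=r'_n(\mu,\mu')+r'_n(\nu,\nu')$ for all $n\ge1$. These conditions determine $\gamma'$ and the moments of $\gamma$. **Corollary.** Suppose that $\mathfrak p=(p_d)_{d\ge1}$ and $\mathfrak q=(q_d)_{d\ge1}$,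 with $p_d,q_d\in\mathcal P_d(\mathbb R)$, have infinitesimal distributions $(\mu,\mu')$ and $(\nu,\nu')$, respectively, and that $\nu=\delta_0$. Then an infinitesimal free additive convolution $(\mu,\mu')\boxplus_B(\nu,\nu')$ exists, and for every such pair $(\gamma,\gamma')$ the sequence $\mathfrak p\boxplus\mathfrak q=(p_d\boxplus_d q_d)_{d\ge1}$ has infinitesimal distribution $(\gamma,\gamma')$; in particular $p_d\boxplus_d q_d\in\mathcal P_d(\mathbb R)$ for every $d\ge1$. -/

import Mathlib

open Polynomial MeasureTheory Filter Topology

namespace FiniteFree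

/-! ### Real-rooted polynomials, root distributions, finite-free additive convolution -/

/-- `p` is a monic real polynomial of degree `d`, all of whose roots are real. -/
structure IsMonicRealRooted (d : ℕ) (p : ℝ[X]) : Prop where
  monic : p.Monic
  natDegree_eq : p.natDegree = d
  splits : p.Splits

/-- The root distribution of `p`: each root, counted with multiplicity, carries mass
`1 / deg p`. -/
noncomputable def rootDistribution (p : ℝ[X]) : Measure ℝ :=
  (p.natDegree : ENNReal)⁻¹ • (p.roots.map fun a : ℝ => Measure.dirac a).sum

/-- The `n`-th moment `∫ tⁿ dμ(t)`. -/
noncomputable def mom (μ : Measure ℝ) (n : ℕ) : ℝ :=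
  ProbabilityTheory.moment (fun t : ℝ => t) n μ

/-- The normalized coefficient `eₖ(p)` of a polynomial of degree `d`, that is,
`p(x) = ∑ₖ x^(d-k) (-1)^k (d choose k) eₖ(p)`; it is used only for `k ≤ d`. -/
noncomputable def normCoeff (d : ℕ) (p : ℝ[X]) (k : ℕ) : ℝ :=
  (-1) ^ k * p.coeff (d - k) / (d.choose k : ℝ)

/-- The finite-free additive convolution of two polynomials of degree `d`. -/
noncomputable def addConv (d : ℕ) (p q : ℝ[X]) : ℝ[X] :=
  ∑ k ∈ Finset.range (d + 1),
    C ((-1) ^ k * (d.choose k : ℝ) *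
      ∑ i ∈ Finset.range (k + 1), (k.choose i : ℝ) * normCoeff d p i * normCoeff d q (k - i))
    * X ^ (d - k)

/-! ### Infinitesimal distributions of sequences of polynomials -/

/-- `μ` is a probability measure on `ℝ` with finite moments of all orders. -/
structure IsLawWithMoments (μ : Measure ℝ) : Prop where
  isProb : IsProbabilityMeasure μ
  integrable : ∀ n : ℕ, Integrable (fun t : ℝ => t ^ n) μ

/-- The sequence `(p d)` for `d ≥ 1` consists of monic real-rooted polynomials with `deg (p d) = d`
and has limiting root distribution `μ`, in the sense of convergence of moments. -/
structure HasLimitingDistribution (p : ℕ → ℝ[X]) (μ : Measure ℝ) : Prop where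
  realRooted : ∀ d : ℕ, 1 ≤ d → IsMonicRealRooted d (p d)
  law : IsLawWithMoments μ
  tendsto : ∀ n : ℕ, Tendsto (fun d : ℕ => mom (rootDistribution (p d)) n) atTop (𝓝 (mom μ n))

/-- The sequence `(p d)` for `d ≥ 1` has infinitesimal distribution `(μ, μ')`: it has limiting root
distribution `μ`, and its infinitesimal moments of all orders exist and are the values
`μ' (xⁿ)`. -/
structure HasInfinitesimalDistribution (p : ℕ → ℝ[X]) (μ : Measure ℝ) (μ' : ℝ[X] →ₗ[ℝ] ℝ) :
    Prop where
  limiting : HasLimitingDistribution p μ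
  tendsto : ∀ n : ℕ, Tendsto
    (fun d : ℕ => (d : ℝ) * (mom (rootDistribution (p d)) n - mom μ n)) atTop (𝓝 (μ' (X ^ n)))

/-! ### Non-crossing partitions and free cumulants -/

/-- A partition of `{0, …, n-1}` is non-crossing if `a < b < c < d` with `a, c` in a block `V` and
`b, d` in a block `W` forces `V = W`. -/
def IsNonCrossing {n : ℕ} (π : Finpartition (Finset.univ : Finset (Fin n))) : Prop :=
  ∀ a b c d : Fin n, a < b → b < c → c < d →
    ∀ V ∈ π.parts, ∀ W ∈ π.parts, a ∈ V → c ∈ V → b ∈ W → d ∈ W → V = W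

open Classical in
/-- The finite set of non-crossing partitions of an `n`-element ordered set. -/
noncomputable def NC (n : ℕ) : Finset (Finpartition (Finset.univ : Finset (Fin n))) :=
  Finset.univ.filter fun π => IsNonCrossing π

open Classical in
/-- The non-crossing partitions different from the one-block partition. -/
noncomputable def properNC (n : ℕ) : Finset (Finpartition (Finset.univ : Finset (Fin n))) :=
  (NC n).filter fun π => π.parts ≠ {Finset.univ}

theorem card_lt_of_mem_properNC {n : ℕ} {π : Finpartition (Finset.univ : Finset (Fin n))}
    (hπ : π ∈ properNC n) {V : Finset (Fin n)} (hV : V ∈ π.parts) : V.card < n := by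
  classical
  have hne : π.parts ≠ {Finset.univ} := (Finset.mem_filter.1 hπ).2
  have hle : V.card ≤ n := by simpa using Finset.card_le_univ V
  refine lt_of_le_of_ne hle fun h => hne ?_
  have hVu : V = Finset.univ := (Finset.card_eq_iff_eq_univ V).1 (by simpa using h)
  refine Finset.eq_singleton_iff_unique_mem.2 ⟨hVu ▸ hV, fun W hW => ?_⟩
  by_contra hWV
  have hdisj := π.disjoint hV hW (fun e => hWV (e ▸ hVu))
  rw [Function.onFun, id, id, hVu] at hdisj
  exact π.ne_bot hW (Finset.eq_empty_of_forall_notMem fun x hx =>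
    Finset.disjoint_left.1 hdisj (Finset.mem_univ x) hx)

/-- The free cumulants `rₙ` of a moment sequence `m`, defined recursively for `n ≥ 1` by
`mₙ = ∑_{π ∈ NC(n)} ∏_{V ∈ π} r_{|V|}`, see `moment_cumulant`. -/
noncomputable def freeCumulant (m : ℕ → ℝ) (n : ℕ) : ℝ :=
  m n - ∑ π ∈ (properNC n).attach, ∏ V ∈ π.1.parts.attach, freeCumulant m V.1.card
termination_by n
decreasing_by exact card_lt_of_mem_properNC π.2 V.2

open Classical in
/-- The infinitesimal free cumulants `r'ₙ` of a pair of moment sequences `(m, m')`, defined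
recursively for `n ≥ 1` by `m'ₙ = ∑_{π ∈ NC(n)} ∑_{V ∈ π} r'_{|V|} ∏_{W ∈ π, W ≠ V} r_{|W|}`, where
`r` are the free cumulants of `m`, see `inf_moment_cumulant`. -/
noncomputable def infFreeCumulant (m m' : ℕ → ℝ) (n : ℕ) : ℝ :=
  m' n - ∑ π ∈ (properNC n).attach, ∑ V ∈ π.1.parts.attach,
    infFreeCumulant m m' V.1.card * ∏ W ∈ π.1.parts.erase V.1, freeCumulant m W.card
termination_by n
decreasing_by exact card_lt_of_mem_properNC π.2 V.2

theorem sum_NC {n : ℕ} (hn : 1 ≤ n)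
    (F : Finset (Finset (Fin n)) → ℝ) :
    ∑ π ∈ NC n, F π.parts = F {Finset.univ} + ∑ π ∈ properNC n, F π.parts := by
  classical
  have hne : (Finset.univ : Finset (Fin n)) ≠ ⊥ := by
    have : Nonempty (Fin n) := ⟨⟨0, hn⟩⟩
    exact Finset.univ_nonempty.ne_empty
  set o : Finpartition (Finset.univ : Finset (Fin n)) := Finpartition.indiscrete hne with ho
  have hop : o.parts = {Finset.univ} := rfl
  have hoNC : o ∈ NC n := by
    refine Finset.mem_filter.2 ⟨Finset.mem_univ _, ?_⟩
    intro a b c d _ _ _ V hV W hW _ _ _ _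
    rw [hop, Finset.mem_singleton] at hV hW
    rw [hV, hW]
  have hprop : properNC n = (NC n).erase o := by
    ext π
    rw [properNC, Finset.mem_filter, Finset.mem_erase, and_comm]
    refine and_congr_left fun _ => not_congr ⟨fun h => Finpartition.ext (h.trans hop.symm),
      fun h => by rw [h, hop]⟩
  rw [hprop, ← Finset.add_sum_erase _ _ hoNC, hop]

/-- The free moment-cumulant formula. -/
theorem moment_cumulant (m : ℕ → ℝ) {n : ℕ} (hn : 1 ≤ n) :
    m n = ∑ π ∈ NC n, ∏ V ∈ π.parts, freeCumulant m V.card := by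
  classical
  rw [sum_NC hn (fun P => ∏ V ∈ P, freeCumulant m V.card), Finset.prod_singleton,
    Finset.card_univ, Fintype.card_fin]
  conv_rhs => rw [freeCumulant]
  rw [← Finset.sum_attach (properNC n)]
  simp only [Finset.prod_attach _ (fun V : Finset (Fin n) => freeCumulant m V.card)]
  ring

open Classical in
/-- The infinitesimal free moment-cumulant formula. -/
theorem inf_moment_cumulant (m m' : ℕ → ℝ) {n : ℕ} (hn : 1 ≤ n) :
    m' n = ∑ π ∈ NC n, ∑ V ∈ π.parts,
      infFreeCumulant m m' V.card * ∏ W ∈ π.parts.erase V, freeCumulant m W.card := by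
  rw [sum_NC hn (fun P => ∑ V ∈ P,
      infFreeCumulant m m' V.card * ∏ W ∈ P.erase V, freeCumulant m W.card), Finset.sum_singleton,
    Finset.card_univ, Fintype.card_fin]
  conv_rhs => rw [infFreeCumulant]
  rw [← Finset.sum_attach (properNC n)]
  have h : ∀ P : Finset (Finset (Fin n)), ∑ V ∈ P.attach, infFreeCumulant m m' V.1.card *
      ∏ W ∈ P.erase V.1, freeCumulant m W.card = ∑ V ∈ P, infFreeCumulant m m' V.card *
      ∏ W ∈ P.erase V, freeCumulant m W.card := fun P =>
    Finset.sum_attach P (fun V => infFreeCumulant m m' V.card *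
      ∏ W ∈ P.erase V, freeCumulant m W.card)
  simp only [h]
  simp

/-! ### Free and infinitesimal free additive convolution -/

/-- `γ` is a free additive convolution `μ ⊞ ν`: a probability measure with finite moments of all
orders whose free cumulants are the sums of those of `μ` and `ν`. -/
structure IsFreeAddConv (μ ν γ : Measure ℝ) : Prop where
  law : IsLawWithMoments γ
  cumulant_add : ∀ n : ℕ, 1 ≤ n →
    freeCumulant (mom γ) n = freeCumulant (mom μ) n + freeCumulant (mom ν) n

/-- The infinitesimal free cumulants of a pair of a measure and a linear functional on
polynomials. -/
noncomputable def infCumulant (μ : Measure ℝ) (μ' : ℝ[X] →ₗ[ℝ] ℝ) (n : ℕ) : ℝ :=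
  infFreeCumulant (mom μ) (fun k => μ' (X ^ k)) n

/-- `(γ, γ')` is the infinitesimal free additive convolution `(μ, μ') ⊞_B (ν, ν')`: `γ = μ ⊞ ν`,
`γ' 1 = 0`, and the infinitesimal free cumulants add up. -/
structure IsInfFreeAddConv (μ : Measure ℝ) (μ' : ℝ[X] →ₗ[ℝ] ℝ) (ν : Measure ℝ)
    (ν' : ℝ[X] →ₗ[ℝ] ℝ) (γ : Measure ℝ) (γ' : ℝ[X] →ₗ[ℝ] ℝ) : Prop where
  freeAddConv : IsFreeAddConv μ ν γ
  map_one : γ' 1 = 0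
  cumulant_add : ∀ n : ℕ, 1 ≤ n → infCumulant γ γ' n = infCumulant μ μ' n + infCumulant ν ν' n

end FiniteFree

namespace FiniteFree

/-! Put `U_d(z) = z^d p_d(1/z) = ∏ (1 - a z)`, the product running over the roots `a` of `p_d`.
Newton's identities read `U_d' = -P_d U_d`, where `P_d` generates the power sums of the roots. Since
`ν = δ₀`, the infinitesimal moments of `q` are the limits of the unnormalized power sums of `q_d`.
Hence the reversed polynomials of `q_d` converge coefficientwise to the solution `E` of `E' = -N E`,
`E(0) = 1`, with `N = ∑ ν'(x^(n+1)) z^n`.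

Convolution with `q_d` is a differential operator with constant coefficients. By Euler's relation
the reversed `k`-th derivative of `p_d` is `d^k G_k U_d`, where `G_k → M^k` and `M` is the moment
series of `μ`. So the reversed convolution divided by `U_d` tends to `E(w)`, with `w = z M(z)`
(`revSeries_addConv`). Taking logarithmic derivatives, the power sums of the convolution minus those
of `p_d` converge to the coefficients of `N(w) w'` (`coeffTendsto_powerSumSeries_addConv`).

On the combinatorial side, splitting a non-crossing partition along the block of its least element
gives `M = 1 + ∑ r_k w^k`. Differentiating this equation in the cumulants, by computing over the
dual numbers, produces the same series `N(w) w'` up to the factor `z`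
(`ncDerivSeries_mul_ncSeries`). This is the amount by which the infinitesimal moments change when
the infinitesimal cumulants of `(δ₀, ν')` are added to those of `(μ, μ')`. The free cumulants of
`δ₀` vanish and the infinitesimal cumulants of `(δ₀, ν')` are its infinitesimal moments, so this is
the claim. All limits are coefficientwise and no analytic convergence is involved.

Real-rootedness (`IsMonicRealRooted.addConv`) is a Grace-type argument: for `Im x > 0` the
polynomial `p(x + ·)` has its zeros in the lower half plane, each root of `q` acts on it by a polar
derivative, and Laguerre's theorem keeps the zeros there. The final constant is the value of the
convolution at `x`, and it is nonzero. -/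

/-! ### Non-crossing partitions as sets of sets -/

/-- `P` is a non-crossing partition of the finite set `s`. -/
structure IsNCPart {α : Type*} [LinearOrder α] (s : Finset α) (P : Finset (Finset α)) : Prop where
  nonempty : ∀ V ∈ P, V.Nonempty
  subset : ∀ V ∈ P, V ⊆ s
  cover : ∀ x ∈ s, ∃ V ∈ P, x ∈ V
  unique : ∀ V ∈ P, ∀ W ∈ P, ∀ x, x ∈ V → x ∈ W → V = W
  nonCrossing : ∀ V ∈ P, ∀ W ∈ P, ∀ a b c d, a < b → b < c → c < d →
    a ∈ V → c ∈ V → b ∈ W → d ∈ W → V = W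

open Classical in
/-- The finite set of non-crossing partitions of `s`. -/
noncomputable def ncParts {α : Type*} [LinearOrder α] (s : Finset α) :
    Finset (Finset (Finset α)) :=
  s.powerset.powerset.filter (IsNCPart s)

theorem mem_ncParts {α : Type*} [LinearOrder α] {s : Finset α} {P : Finset (Finset α)} :
    P ∈ ncParts s ↔ IsNCPart s P := by
  classical
  rw [ncParts, Finset.mem_filter, and_iff_right_iff_imp]
  intro h
  rw [Finset.mem_powerset]
  intro V hV
  exact Finset.mem_powerset.2 (h.subset V hV)

theorem mem_ncParts_parts {n : ℕ} (π : Finpartition (Finset.univ : Finset (Fin n))) :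
    π ∈ NC n ↔ IsNCPart Finset.univ π.parts := by
  classical
  rw [NC, Finset.mem_filter, and_iff_right (Finset.mem_univ _)]
  constructor
  · intro h
    refine ⟨fun V hV => π.nonempty_of_mem_parts hV, fun V _ => Finset.subset_univ V,
      fun x hx => π.exists_mem hx, fun V hV W hW x hxV hxW => π.eq_of_mem_parts hV hW hxV hxW, ?_⟩
    intro V hV W hW a b c d hab hbc hcd ha hc hb hd
    exact h a b c d hab hbc hcd V hV W hW ha hc hb hd
  · intro h a b c d hab hbc hcd V hV W hW ha hc hb hd
    exact h.nonCrossing V hV W hW a b c d hab hbc hcd ha hc hb hd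

/-- Sets of sets on an arbitrary finite ground set can be restricted to subintervals and glued,
which the recursion below requires. -/
theorem sum_NC_eq_sum_ncParts {R : Type*} [AddCommMonoid R] {n : ℕ}
    (F : Finset (Finset (Fin n)) → R) :
    ∑ π ∈ NC n, F π.parts = ∑ P ∈ ncParts (Finset.univ : Finset (Fin n)), F P := by
  classical
  refine Finset.sum_bij (fun π _ => π.parts) (fun π hπ => ?_) (fun π _ π' _ h => ?_)
    (fun P hP => ?_) (fun _ _ => rfl)
  · exact mem_ncParts.2 ((mem_ncParts_parts π).1 hπ)
  · exact Finpartition.ext h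
  · have h := mem_ncParts.1 hP
    let π : Finpartition (Finset.univ : Finset (Fin n)) := Finpartition.ofExistsUnique P
      (fun V _ => Finset.subset_univ V)
      (fun x hx => by
        obtain ⟨V, hV, hxV⟩ := h.cover x hx
        exact ⟨V, ⟨hV, hxV⟩, fun W hW => h.unique W hW.1 V hV x hW.2 hxV⟩)
      (fun hbot => by simpa using h.nonempty _ hbot)
    exact ⟨π, (mem_ncParts_parts π).2 h, rfl⟩

variable {R : Type*} [CommRing R]

/-- The sum over all non-crossing partitions of `s` of the product of the weights of the blocks,
where a block of size `k` has weight `r k`. -/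
noncomputable def ncSum {α : Type*} [LinearOrder α] (r : ℕ → R) (s : Finset α) : R :=
  ∑ P ∈ ncParts s, ∏ V ∈ P, r V.card

/-! ### Transport along order embeddings -/

theorem IsNCPart.map {α β : Type*} [LinearOrder α] [LinearOrder β] (f : α ↪o β)
    {s : Finset α} {P : Finset (Finset α)} (h : IsNCPart s P) :
    IsNCPart (s.map f.toEmbedding) (P.map (Finset.mapEmbedding f.toEmbedding).toEmbedding) := by
  constructor
  · intro V hV
    obtain ⟨V, hV0, rfl⟩ := Finset.mem_map.1 hV
    simpa using h.nonempty V hV0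
  · intro V hV
    obtain ⟨V, hV0, rfl⟩ := Finset.mem_map.1 hV
    simpa using h.subset V hV0
  · intro x hx
    obtain ⟨x, hx0, rfl⟩ := Finset.mem_map.1 hx
    obtain ⟨V, hV, hxV⟩ := h.cover x hx0
    exact ⟨_, Finset.mem_map_of_mem _ hV, by simpa using hxV⟩
  · intro V hV W hW x hxV hxW
    obtain ⟨V, hV0, rfl⟩ := Finset.mem_map.1 hV
    obtain ⟨W, hW0, rfl⟩ := Finset.mem_map.1 hW
    obtain ⟨x, hx0, rfl⟩ := Finset.mem_map.1 hxV
    have hxW' : x ∈ W := by simpa using hxW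
    rw [h.unique V hV0 W hW0 x hx0 hxW']
  · intro V hV W hW a b c d hab hbc hcd ha hc hb hd
    obtain ⟨V, hV0, rfl⟩ := Finset.mem_map.1 hV
    obtain ⟨W, hW0, rfl⟩ := Finset.mem_map.1 hW
    obtain ⟨a, ha0, rfl⟩ := Finset.mem_map.1 ha
    obtain ⟨b, hb0, rfl⟩ := Finset.mem_map.1 hb
    obtain ⟨c, hc0, rfl⟩ := Finset.mem_map.1 hc
    obtain ⟨d, hd0, rfl⟩ := Finset.mem_map.1 hd
    rw [h.nonCrossing V hV0 W hW0 a b c d (f.lt_iff_lt.1 hab) (f.lt_iff_lt.1 hbc)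
      (f.lt_iff_lt.1 hcd) ha0 hc0 hb0 hd0]

theorem IsNCPart.exists_of_map {α β : Type*} [LinearOrder α] [LinearOrder β] (f : α ↪o β)
    {s : Finset α} {Q : Finset (Finset β)} (h : IsNCPart (s.map f.toEmbedding) Q) :
    ∃ P, IsNCPart s P ∧ P.map (Finset.mapEmbedding f.toEmbedding).toEmbedding = Q := by
  classical
  have key : ∀ W ∈ Q, ∃ V ⊆ s, V.map f.toEmbedding = W := fun W hW => by
    obtain ⟨V, hV, rfl⟩ := Finset.subset_map_iff.1 (h.subset W hW)
    exact ⟨V, hV, rfl⟩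
  have hinj : Function.Injective (fun V : Finset α => V.map f.toEmbedding) :=
    Finset.map_injective _
  refine ⟨s.powerset.filter (fun V => V.map f.toEmbedding ∈ Q), ⟨?_, ?_, ?_, ?_, ?_⟩, ?_⟩
  · intro V hV
    simpa using h.nonempty _ (Finset.mem_filter.1 hV).2
  · intro V hV
    exact Finset.mem_powerset.1 (Finset.mem_filter.1 hV).1
  · intro x hx
    obtain ⟨W, hW, hxW⟩ := h.cover (f x) (Finset.mem_map_of_mem f.toEmbedding hx)
    obtain ⟨V, hV, rfl⟩ := key W hW
    exact ⟨V, Finset.mem_filter.2 ⟨Finset.mem_powerset.2 hV, hW⟩, by simpa using hxW⟩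
  · intro V hV W hW x hxV hxW
    exact hinj (h.unique _ (Finset.mem_filter.1 hV).2 _ (Finset.mem_filter.1 hW).2 (f x)
      (Finset.mem_map_of_mem f.toEmbedding hxV) (Finset.mem_map_of_mem f.toEmbedding hxW))
  · intro V hV W hW a b c d hab hbc hcd ha hc hb hd
    exact hinj (h.nonCrossing _ (Finset.mem_filter.1 hV).2 _ (Finset.mem_filter.1 hW).2
      (f a) (f b) (f c) (f d) (f.lt_iff_lt.2 hab) (f.lt_iff_lt.2 hbc) (f.lt_iff_lt.2 hcd)
      (Finset.mem_map_of_mem f.toEmbedding ha) (Finset.mem_map_of_mem f.toEmbedding hc)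
      (Finset.mem_map_of_mem f.toEmbedding hb) (Finset.mem_map_of_mem f.toEmbedding hd))
  · ext W
    simp only [Finset.mem_map, Finset.mem_filter, Finset.mem_powerset]
    constructor
    · rintro ⟨V, ⟨_, hVQ⟩, rfl⟩
      exact hVQ
    · intro hW
      obtain ⟨V, hV, rfl⟩ := key W hW
      exact ⟨V, ⟨hV, hW⟩, rfl⟩

/-- Makes `ncSum` depend only on the size of the ground set, so that gaps between elements of a
block can be identified with initial segments. -/
theorem ncSum_map {α β : Type*} [LinearOrder α] [LinearOrder β] (f : α ↪o β) (r : ℕ → R)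
    (s : Finset α) : ncSum r (s.map f.toEmbedding) = ncSum r s := by
  symm
  refine Finset.sum_bij (fun P _ => P.map (Finset.mapEmbedding f.toEmbedding).toEmbedding)
    (fun P hP => mem_ncParts.2 ((mem_ncParts.1 hP).map f))
    (fun P _ P' _ h => Finset.map_injective _ h) (fun Q hQ => ?_) (fun P _ => ?_)
  · obtain ⟨P, hP, rfl⟩ := (mem_ncParts.1 hQ).exists_of_map f
    exact ⟨P, mem_ncParts.2 hP, rfl⟩
  · rw [Finset.prod_map]
    simp

theorem ncSum_univ_fin (r : ℕ → R) (n : ℕ) :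
    ncSum r (Finset.univ : Finset (Fin n)) = ncSum r (Finset.range n) := by
  rw [← ncSum_map (Fin.valOrderEmb n) r Finset.univ]
  congr 1
  ext x
  simp only [Finset.mem_map, Finset.mem_univ, true_and, Finset.mem_range]
  exact ⟨fun ⟨a, ha⟩ => ha ▸ a.2, fun h => ⟨⟨x, h⟩, rfl⟩⟩

theorem ncSum_Ico (r : ℕ → R) (a n : ℕ) :
    ncSum r (Finset.Ico a (a + n)) = ncSum r (Finset.range n) := by
  rw [← ncSum_map (OrderEmbedding.addLeft a) r (Finset.range n)]
  congr 1
  ext x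
  simp only [Finset.mem_map, Finset.mem_range, Finset.mem_Ico]
  constructor
  · intro h
    exact ⟨x - a, by omega, by change a + (x - a) = x; omega⟩
  · rintro ⟨y, hy, rfl⟩
    change a ≤ a + y ∧ a + y < a + n
    omega

/-! ### Decomposition along the block of the least element -/

/-- `V` together with the blocks in `P` is a non-crossing partition of `{0, …, n-1}` with `0 ∈ V`;
for `n = 0` this means that `V` and `P` are empty. -/
structure IsMarked (n : ℕ) (V : Finset ℕ) (P : Finset (Finset ℕ)) : Prop where
  lt : ∀ x ∈ V, x < n
  nonempty : ∀ W ∈ P, W.Nonempty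
  block_lt : ∀ W ∈ P, ∀ x ∈ W, x < n
  notMem : ∀ W ∈ P, ∀ x ∈ W, x ∉ V
  cover : ∀ x < n, x ∈ V ∨ ∃ W ∈ P, x ∈ W
  unique : ∀ V ∈ P, ∀ W ∈ P, ∀ x, x ∈ V → x ∈ W → V = W
  nonCrossing : ∀ V ∈ P, ∀ W ∈ P, ∀ a b c d, a < b → b < c → c < d →
    a ∈ V → c ∈ V → b ∈ W → d ∈ W → V = W
  separate : ∀ W ∈ P, ∀ a ∈ W, ∀ b ∈ W, ∀ v ∈ V, a < v → v < b → False
  zero_mem : 0 < n → 0 ∈ V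

open Classical in
/-- The pairs `(V, P)` with `IsMarked n V P` and `V` of size `k`. -/
noncomputable def markedParts (k n : ℕ) : Finset (Finset ℕ × Finset (Finset ℕ)) :=
  ((Finset.range n).powerset ×ˢ (Finset.range n).powerset.powerset).filter
    fun A => IsMarked n A.1 A.2 ∧ A.1.card = k

theorem mem_markedParts {k n : ℕ} {A : Finset ℕ × Finset (Finset ℕ)} :
    A ∈ markedParts k n ↔ IsMarked n A.1 A.2 ∧ A.1.card = k := by
  classical
  rw [markedParts, Finset.mem_filter, and_iff_right_iff_imp, Finset.mem_product]
  rintro ⟨h, -⟩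
  refine ⟨Finset.mem_powerset.2 fun x hx => Finset.mem_range.2 (h.lt x hx),
    Finset.mem_powerset.2 fun W hW => Finset.mem_powerset.2 fun x hx =>
      Finset.mem_range.2 (h.block_lt W hW x hx)⟩

/-- The weighted count of the non-crossing partitions of `{0, …, n-1}` whose block at `0` has size
`k`, this block being given the weight `1`. -/
noncomputable def markedSum (r : ℕ → R) (k n : ℕ) : R :=
  ∑ A ∈ markedParts k n, ∏ W ∈ A.2, r W.card

theorem IsNCPart.isMarked_erase {n : ℕ} {P : Finset (Finset ℕ)} (h : IsNCPart (Finset.range n) P)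
    {V : Finset ℕ} (hV : V ∈ P) (h0 : 0 ∈ V) : IsMarked n V (P.erase V) := by
  have hu := h.unique
  have hs := h.subset
  have hn := h.nonCrossing
  refine ⟨?_, ?_, ?_, ?_, ?_, ?_, ?_, ?_, ?_⟩
  · exact fun x hx => Finset.mem_range.1 (hs V hV hx)
  · exact fun W hW => h.nonempty W (Finset.mem_of_mem_erase hW)
  · exact fun W hW x hx => Finset.mem_range.1 (hs W (Finset.mem_of_mem_erase hW) hx)
  · intro W hW x hx hxV
    exact Finset.ne_of_mem_erase hW (hu W (Finset.mem_of_mem_erase hW) V hV x hx hxV)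
  · intro x hx
    obtain ⟨W, hW, hxW⟩ := h.cover x (Finset.mem_range.2 hx)
    by_cases e : W = V
    · exact Or.inl (e ▸ hxW)
    · exact Or.inr ⟨W, Finset.mem_erase.2 ⟨e, hW⟩, hxW⟩
  · exact fun V hV W hW => hu V (Finset.mem_of_mem_erase hV) W (Finset.mem_of_mem_erase hW)
  · exact fun V hV W hW => hn V (Finset.mem_of_mem_erase hV) W (Finset.mem_of_mem_erase hW)
  · intro W hW a ha b hb v hv hav hvb
    have hWP := Finset.mem_of_mem_erase hW
    refine Finset.ne_of_mem_erase hW ?_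
    -- If `a ≠ 0`, then `0 < a < v < b` with `0, v ∈ V` and `a, b ∈ W` is a crossing.
    rcases Nat.eq_zero_or_pos a with rfl | h0a
    · exact hu W hWP V hV 0 ha h0
    · exact (hn V hV W hWP 0 a v b h0a hav hvb h0 hv ha hb).symm
  · exact fun _ => h0

theorem IsMarked.isNCPart_insert {n : ℕ} (hn : 0 < n) {V : Finset ℕ} {P : Finset (Finset ℕ)}
    (h : IsMarked n V P) : IsNCPart (Finset.range n) (insert V P) := by
  have h0 := h.zero_mem hn
  refine ⟨?_, ?_, ?_, ?_, ?_⟩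
  · intro W hW
    rcases Finset.mem_insert.1 hW with rfl | hW
    · exact ⟨0, h0⟩
    · exact h.nonempty W hW
  · intro W hW x hx
    rcases Finset.mem_insert.1 hW with rfl | hW
    · exact Finset.mem_range.2 (h.lt x hx)
    · exact Finset.mem_range.2 (h.block_lt W hW x hx)
  · intro x hx
    rcases h.cover x (Finset.mem_range.1 hx) with hx | ⟨W, hW, hx⟩
    · exact ⟨V, Finset.mem_insert_self _ _, hx⟩
    · exact ⟨W, Finset.mem_insert_of_mem hW, hx⟩
  · intro A hA B hB x hxA hxB
    rcases Finset.mem_insert.1 hA with hA | hA <;> rcases Finset.mem_insert.1 hB with hB | hB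
    · rw [hA, hB]
    · exact (h.notMem B hB x hxB (hA ▸ hxA)).elim
    · exact (h.notMem A hA x hxA (hB ▸ hxB)).elim
    · exact h.unique A hA B hB x hxA hxB
  · intro A hA B hB a b c d hab hbc hcd ha hc hb hd
    rcases Finset.mem_insert.1 hA with hA | hA <;> rcases Finset.mem_insert.1 hB with hB | hB
    · rw [hA, hB]
    · exact (h.separate B hB b hb d hd c (hA ▸ hc) hbc hcd).elim
    · exact (h.separate A hA a ha c hc b (hB ▸ hb) hab hbc).elim
    · exact h.nonCrossing A hA B hB a b c d hab hbc hcd ha hc hb hd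

theorem ncSum_range_eq_sum_markedSum (r : ℕ → R) {n : ℕ} (hn : 0 < n) :
    ncSum r (Finset.range n) = ∑ k ∈ Finset.range (n + 1), r k * markedSum r k n := by
  classical
  simp only [markedSum, Finset.mul_sum]
  rw [Finset.sum_sigma', ncSum]
  symm
  refine Finset.sum_bij (fun A _ => insert A.2.1 A.2.2) ?_ ?_ ?_ ?_
  · rintro ⟨k, V, P⟩ hA
    simp only [Finset.mem_sigma, mem_markedParts] at hA
    exact mem_ncParts.2 (hA.2.1.isNCPart_insert hn)
  · rintro ⟨k, V, P⟩ hA ⟨k', V', P'⟩ hA' he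
    simp only [Finset.mem_sigma, mem_markedParts] at hA hA'
    obtain ⟨-, hA, rfl⟩ := hA
    obtain ⟨-, hA', rfl⟩ := hA'
    simp only at he
    have hVP : V ∉ P := fun hV => hA.notMem V hV 0 (hA.zero_mem hn) (hA.zero_mem hn)
    have hVP' : V' ∉ P' := fun hV => hA'.notMem V' hV 0 (hA'.zero_mem hn) (hA'.zero_mem hn)
    -- The marked block is recovered as the only block that contains `0`.
    have hVV : V = V' := by
      have h1 : V ∈ insert V' P' := he ▸ Finset.mem_insert_self _ _
      rcases Finset.mem_insert.1 h1 with h1 | h1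
      · exact h1
      · exact (hA'.notMem V h1 0 (hA.zero_mem hn) (hA'.zero_mem hn)).elim
    subst hVV
    have : P = P' := by
      rw [← Finset.erase_insert hVP, he, Finset.erase_insert hVP']
    rw [this]
  · intro P hP
    have h := mem_ncParts.1 hP
    obtain ⟨V, hV, h0⟩ := h.cover 0 (Finset.mem_range.2 hn)
    refine ⟨⟨V.card, V, P.erase V⟩, ?_, Finset.insert_erase hV⟩
    simp only [Finset.mem_sigma, mem_markedParts, Finset.mem_range]
    refine ⟨?_, h.isMarked_erase hV h0, trivial⟩
    have := Finset.card_le_card (h.subset V hV)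
    rw [Finset.card_range] at this
    omega
  · rintro ⟨k, V, P⟩ hA
    simp only [Finset.mem_sigma, mem_markedParts] at hA
    obtain ⟨-, hA, rfl⟩ := hA
    have hVP : V ∉ P := fun hV => hA.notMem V hV 0 (hA.zero_mem hn) (hA.zero_mem hn)
    rw [Finset.prod_insert hVP]

/-! ### Splitting a marked partition at the last element of its marked block -/

theorem IsMarked.insert_union {x n : ℕ} (hx : x < n) {V : Finset ℕ} {P Q : Finset (Finset ℕ)}
    (h : IsMarked x V P) (hQ : IsNCPart (Finset.Ico (x + 1) n) Q) :
    IsMarked n (insert x V) (P ∪ Q) := by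
  obtain ⟨h1, h2, h3, h4, h5, h6, h7, h8, h9⟩ := h
  obtain ⟨q1, q2, q3, q4, q5⟩ := hQ
  have q2' : ∀ W ∈ Q, ∀ y ∈ W, x < y ∧ y < n := fun W hW y hy => by
    have := Finset.mem_Ico.1 (q2 W hW hy)
    omega
  clear q2
  constructor
  · intro y hy
    rcases Finset.mem_insert.1 hy with rfl | hy
    · exact hx
    · exact (h1 y hy).trans hx
  · intro W hW
    rcases Finset.mem_union.1 hW with hW | hW
    exacts [h2 W hW, q1 W hW]
  · intro W hW y hy
    rcases Finset.mem_union.1 hW with hW | hW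
    exacts [(h3 W hW y hy).trans hx, (q2' W hW y hy).2]
  · intro W hW y hy
    rw [Finset.mem_insert, not_or]
    rcases Finset.mem_union.1 hW with hW | hW
    · exact ⟨(h3 W hW y hy).ne, h4 W hW y hy⟩
    · have := q2' W hW y hy
      exact ⟨by omega, fun hyV => by have := h1 y hyV; omega⟩
  · intro y hy
    rcases lt_trichotomy y x with hyx | rfl | hyx
    · rcases h5 y hyx with h | ⟨W, hW, h⟩
      · exact Or.inl (Finset.mem_insert_of_mem h)
      · exact Or.inr ⟨W, Finset.mem_union_left _ hW, h⟩
    · exact Or.inl (Finset.mem_insert_self _ _)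
    · obtain ⟨W, hW, h⟩ := q3 y (Finset.mem_Ico.2 ⟨hyx, hy⟩)
      exact Or.inr ⟨W, Finset.mem_union_right _ hW, h⟩
  · intro A hA B hB y hyA hyB
    rcases Finset.mem_union.1 hA with hA | hA <;> rcases Finset.mem_union.1 hB with hB | hB
    · exact h6 A hA B hB y hyA hyB
    · have := h3 A hA y hyA
      have := q2' B hB y hyB
      omega
    · have := h3 B hB y hyB
      have := q2' A hA y hyA
      omega
    · exact q4 A hA B hB y hyA hyB
  · intro A hA B hB a b c d hab hbc hcd ha hc hb hd
    rcases Finset.mem_union.1 hA with hA | hA <;> rcases Finset.mem_union.1 hB with hB | hB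
    · exact h7 A hA B hB a b c d hab hbc hcd ha hc hb hd
    · have := h3 A hA c hc
      have := q2' B hB b hb
      omega
    · have := h3 B hB b hb
      have := q2' A hA a ha
      omega
    · exact q5 A hA B hB a b c d hab hbc hcd ha hc hb hd
  · intro W hW a ha b hb v hv hav hvb
    rcases Finset.mem_insert.1 hv with rfl | hv <;> rcases Finset.mem_union.1 hW with hW | hW
    · have := h3 W hW b hb
      omega
    · have := q2' W hW a ha
      omega
    · exact h8 W hW a ha b hb v hv hav hvb
    · have := h1 v hv
      have := q2' W hW a ha
      omega
  · intro _
    rcases Nat.eq_zero_or_pos x with rfl | hx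
    · exact Finset.mem_insert_self _ _
    · exact Finset.mem_insert_of_mem (h9 hx)

/-- A block with elements on both sides of `x` would enclose an element of the marked block, which
`separate` forbids. -/
theorem IsMarked.lt_or_lt {x n : ℕ} {V : Finset ℕ} {P : Finset (Finset ℕ)}
    (h : IsMarked n V P) (hx : x ∈ V) {W : Finset ℕ} (hW : W ∈ P) :
    (∀ y ∈ W, y < x) ∨ ∀ y ∈ W, x < y := by
  by_contra hc
  push Not at hc
  obtain ⟨⟨a, ha, hxa⟩, b, hb, hbx⟩ := hc
  have ha' : a ≠ x := fun e => h.notMem W hW a ha (e ▸ hx)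
  have hb' : b ≠ x := fun e => h.notMem W hW b hb (e ▸ hx)
  exact h.separate W hW b hb a ha x hx (by omega) (by omega)

/-- If `x = 0`, the left part is the empty marked partition of the empty set; this is why `IsMarked`
admits `n = 0` with an empty marked block. -/
theorem IsMarked.filter_lt {x n : ℕ} {V : Finset ℕ} {P : Finset (Finset ℕ)}
    (h : IsMarked n V P) (hx : x ∈ V) (hmax : ∀ v ∈ V, v ≤ x) :
    IsMarked x (V.erase x) (P.filter fun W => ∀ y ∈ W, y < x) := by
  have hxn := h.lt x hx
  constructor
  · intro v hv
    exact lt_of_le_of_ne (hmax v (Finset.mem_of_mem_erase hv)) (Finset.ne_of_mem_erase hv)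
  · exact fun W hW => h.nonempty W (Finset.mem_filter.1 hW).1
  · exact fun W hW y hy => (Finset.mem_filter.1 hW).2 y hy
  · exact fun W hW y hy hyV =>
      h.notMem W (Finset.mem_filter.1 hW).1 y hy (Finset.mem_of_mem_erase hyV)
  · intro y hy
    rcases h.cover y (hy.trans hxn) with hyV | ⟨W, hW, hyW⟩
    · exact Or.inl (Finset.mem_erase.2 ⟨hy.ne, hyV⟩)
    · refine Or.inr ⟨W, Finset.mem_filter.2 ⟨hW, ?_⟩, hyW⟩
      rcases h.lt_or_lt hx hW with h1 | h1
      · exact h1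
      · exact absurd (h1 y hyW) (by omega)
  · exact fun A hA B hB => h.unique A (Finset.mem_filter.1 hA).1 B (Finset.mem_filter.1 hB).1
  · exact fun A hA B hB => h.nonCrossing A (Finset.mem_filter.1 hA).1 B (Finset.mem_filter.1 hB).1
  · exact fun W hW a ha b hb v hv =>
      h.separate W (Finset.mem_filter.1 hW).1 a ha b hb v (Finset.mem_of_mem_erase hv)
  · exact fun h0 => Finset.mem_erase.2 ⟨h0.ne, h.zero_mem (h0.trans hxn)⟩

theorem IsMarked.filter_not_lt {x n : ℕ} {V : Finset ℕ} {P : Finset (Finset ℕ)}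
    (h : IsMarked n V P) (hx : x ∈ V) (hmax : ∀ v ∈ V, v ≤ x) :
    IsNCPart (Finset.Ico (x + 1) n) (P.filter fun W => ¬ ∀ y ∈ W, y < x) := by
  constructor
  · exact fun W hW => h.nonempty W (Finset.mem_filter.1 hW).1
  · intro W hW y hy
    obtain ⟨hW, hW'⟩ := Finset.mem_filter.1 hW
    exact Finset.mem_Ico.2 ⟨((h.lt_or_lt hx hW).resolve_left hW') y hy, h.block_lt W hW y hy⟩
  · intro y hy
    obtain ⟨hxy, hyn⟩ := Finset.mem_Ico.1 hy
    rcases h.cover y hyn with hyV | ⟨W, hW, hyW⟩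
    · exact absurd (hmax y hyV) (by omega)
    · exact ⟨W, Finset.mem_filter.2 ⟨hW, fun hc => absurd (hc y hyW) (by omega)⟩, hyW⟩
  · exact fun A hA B hB => h.unique A (Finset.mem_filter.1 hA).1 B (Finset.mem_filter.1 hB).1
  · exact fun A hA B hB => h.nonCrossing A (Finset.mem_filter.1 hA).1 B (Finset.mem_filter.1 hB).1

/-- Here `x` is the last element of the marked block. No other block straddles it, so the blocks to
its left, with the rest of the marked block, and the blocks to its right, on the remaining `n - 1 -
x` points, can be chosen independently. -/
theorem markedSum_succ (r : ℕ → R) (k n : ℕ) :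
    markedSum r (k + 1) n =
      ∑ x ∈ Finset.range n, markedSum r k x * ncSum r (Finset.range (n - 1 - x)) := by
  classical
  have hI : ∀ x ∈ Finset.range n, markedSum r k x * ncSum r (Finset.range (n - 1 - x)) =
      ∑ B ∈ markedParts k x ×ˢ ncParts (Finset.Ico (x + 1) n),
        (∏ W ∈ B.1.2, r W.card) * ∏ W ∈ B.2, r W.card := by
    intro x hx
    have hx := Finset.mem_range.1 hx
    rw [← ncSum_Ico r (x + 1), show x + 1 + (n - 1 - x) = n by omega, markedSum, ncSum,
      Finset.sum_mul_sum, Finset.sum_product]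
  rw [Finset.sum_congr rfl hI, Finset.sum_sigma', markedSum]
  have hfilter : ∀ {x : ℕ} {A : Finset ℕ × Finset (Finset ℕ)} {Q : Finset (Finset ℕ)},
      IsMarked x A.1 A.2 → IsNCPart (Finset.Ico (x + 1) n) Q →
      ((A.2 ∪ Q).filter fun W => ∀ y ∈ W, y < x) = A.2 ∧
      ((A.2 ∪ Q).filter fun W => ¬ ∀ y ∈ W, y < x) = Q := by
    intro x A Q hA hQ
    have h1 : ∀ W ∈ A.2, ∀ y ∈ W, y < x := hA.block_lt
    have h2 : ∀ W ∈ Q, ¬ ∀ y ∈ W, y < x := fun W hW hc => by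
      obtain ⟨y, hy⟩ := hQ.nonempty W hW
      have := hc y hy
      have := Finset.mem_Ico.1 (hQ.subset W hW hy)
      omega
    constructor
    · rw [Finset.filter_union, Finset.filter_true_of_mem h1, Finset.filter_false_of_mem h2,
        Finset.union_empty]
    · rw [Finset.filter_union, Finset.filter_true_of_mem h2,
        Finset.filter_false_of_mem (fun W hW hc => hc (h1 W hW)), Finset.empty_union]
  symm
  refine Finset.sum_bij (fun B _ => (insert B.1 B.2.1.1, B.2.1.2 ∪ B.2.2)) ?_ ?_ ?_ ?_
  · rintro ⟨x, A, Q⟩ hB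
    simp only [Finset.mem_sigma, Finset.mem_product, mem_markedParts, mem_ncParts,
      Finset.mem_range] at hB
    obtain ⟨hx, ⟨hA, rfl⟩, hQ⟩ := hB
    refine mem_markedParts.2 ⟨hA.insert_union hx hQ, ?_⟩
    exact Finset.card_insert_of_notMem fun hxA => (hA.lt x hxA).false
  · rintro ⟨x, A, Q⟩ hB ⟨x', A', Q'⟩ hB' he
    simp only [Finset.mem_sigma, Finset.mem_product, mem_markedParts, mem_ncParts,
      Finset.mem_range] at hB hB'
    obtain ⟨hx, ⟨hA, -⟩, hQ⟩ := hB
    obtain ⟨hx', ⟨hA', -⟩, hQ'⟩ := hB'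
    simp only [Prod.mk.injEq] at he
    obtain ⟨he1, he2⟩ := he
    have hxx : x = x' := by
      have h1 : x ∈ insert x' A'.1 := he1 ▸ Finset.mem_insert_self _ _
      have h2 : x' ∈ insert x A.1 := he1 ▸ Finset.mem_insert_self _ _
      rcases Finset.mem_insert.1 h1 with h1 | h1
      · exact h1
      · rcases Finset.mem_insert.1 h2 with h2 | h2
        · exact h2.symm
        · have := hA.lt _ h2
          have := hA'.lt _ h1
          omega
    subst hxx
    have hV : A.1 = A'.1 := by
      rw [← Finset.erase_insert (fun hxA => (hA.lt x hxA).false : x ∉ A.1), he1,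
        Finset.erase_insert (fun hxA => (hA'.lt x hxA).false)]
    have hP : A.2 = A'.2 := by rw [← (hfilter hA hQ).1, he2, (hfilter hA' hQ').1]
    have hQQ : Q = Q' := by rw [← (hfilter hA hQ).2, he2, (hfilter hA' hQ').2]
    rw [Prod.ext hV hP, hQQ]
  · rintro ⟨V, P⟩ hA
    obtain ⟨hA, hk⟩ := mem_markedParts.1 hA
    have hne : V.Nonempty := Finset.card_pos.1 (by simp only at hk; omega)
    have hmem := V.max'_mem hne
    have hmax : ∀ v ∈ V, v ≤ V.max' hne := fun v hv => V.le_max' v hv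
    refine ⟨⟨V.max' hne, (V.erase (V.max' hne), P.filter fun W => ∀ y ∈ W, y < V.max' hne),
      P.filter fun W => ¬ ∀ y ∈ W, y < V.max' hne⟩, ?_, ?_⟩
    · simp only [Finset.mem_sigma, Finset.mem_product, mem_markedParts, mem_ncParts,
        Finset.mem_range]
      refine ⟨hA.lt _ hmem, ⟨hA.filter_lt hmem hmax, ?_⟩, hA.filter_not_lt hmem hmax⟩
      rw [Finset.card_erase_of_mem hmem]
      simp only at hk
      omega
    · exact Prod.ext (Finset.insert_erase hmem) (Finset.filter_union_filter_not_eq _ _)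
  · rintro ⟨x, A, Q⟩ hB
    simp only [Finset.mem_sigma, Finset.mem_product, mem_markedParts, mem_ncParts,
      Finset.mem_range] at hB
    obtain ⟨hx, ⟨hA, -⟩, hQ⟩ := hB
    refine (Finset.prod_union ?_).symm
    refine Finset.disjoint_left.2 fun W hW hWQ => ?_
    obtain ⟨y, hy⟩ := hA.nonempty W hW
    have := hA.block_lt W hW y hy
    have := Finset.mem_Ico.1 (hQ.subset W hWQ hy)
    omega

theorem ncSum_empty {α : Type*} [LinearOrder α] (r : ℕ → R) : ncSum r (∅ : Finset α) = 1 := by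
  classical
  have : ncParts (∅ : Finset α) = {∅} := by
    ext P
    rw [mem_ncParts, Finset.mem_singleton]
    constructor
    · intro h
      refine Finset.eq_empty_of_forall_notMem fun V hV => ?_
      obtain ⟨x, hx⟩ := h.nonempty V hV
      exact Finset.notMem_empty x (h.subset V hV hx)
    · rintro rfl
      constructor <;> simp
  rw [ncSum, this, Finset.sum_singleton, Finset.prod_empty]

theorem markedSum_zero (r : ℕ → R) (n : ℕ) : markedSum r 0 n = if n = 0 then 1 else 0 := by
  classical
  split_ifs with hn
  · subst hn
    have : markedParts 0 0 = {(∅, ∅)} := by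
      ext ⟨V, P⟩
      rw [mem_markedParts, Finset.mem_singleton]
      constructor
      · rintro ⟨h, -⟩
        refine Prod.ext (Finset.eq_empty_of_forall_notMem fun x hx => ?_)
          (Finset.eq_empty_of_forall_notMem fun W hW => ?_)
        · exact absurd (h.lt x hx) (Nat.not_lt_zero x)
        · obtain ⟨x, hx⟩ := h.nonempty W hW
          exact absurd (h.block_lt W hW x hx) (Nat.not_lt_zero x)
      · intro h
        rw [Prod.mk.injEq] at h
        obtain ⟨rfl, rfl⟩ := h
        refine ⟨?_, rfl⟩
        constructor <;> simp
    rw [markedSum, this, Finset.sum_singleton, Finset.prod_empty]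
  · rw [markedSum, Finset.sum_eq_zero]
    intro A hA
    obtain ⟨h, h0⟩ := mem_markedParts.1 hA
    have := h.zero_mem (Nat.pos_of_ne_zero hn)
    rw [Finset.card_eq_zero.1 h0] at this
    exact absurd this (Finset.notMem_empty 0)

/-! ### Generating functions -/

/-- The generating function of the moments with free cumulants `r`. -/
noncomputable def ncSeries (r : ℕ → R) : PowerSeries R :=
  PowerSeries.mk fun n => ncSum r (Finset.range n)

/-- The recursion `markedSum_succ` is the Cauchy product with one more factor `z M(z)`: the factor
`z` accounts for the last element of the marked block, and `M` for the gap after it. -/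
theorem coeff_X_mul_ncSeries_pow (r : ℕ → R) (k n : ℕ) :
    PowerSeries.coeff n ((PowerSeries.X * ncSeries r) ^ k) = markedSum r k n := by
  induction k generalizing n with
  | zero => rw [pow_zero, PowerSeries.coeff_one, markedSum_zero]
  | succ k ih =>
    rw [markedSum_succ, pow_succ, mul_left_comm]
    cases n with
    | zero => simp
    | succ n =>
      rw [PowerSeries.coeff_succ_X_mul, PowerSeries.coeff_mul,
        Finset.Nat.sum_antidiagonal_eq_sum_range_succ_mk]
      refine Finset.sum_congr rfl fun x _ => ?_
      rw [ih, ncSeries, PowerSeries.coeff_mk, Nat.add_sub_cancel]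

/-- The functional equation `M(z) = 1 + ∑ₖ rₖ (z M(z))^k`. -/
theorem coeff_ncSeries (r : ℕ → R) {n : ℕ} (hn : 0 < n) :
    PowerSeries.coeff n (ncSeries r) = ∑ k ∈ Finset.range (n + 1),
      r k * PowerSeries.coeff n ((PowerSeries.X * ncSeries r) ^ k) := by
  simp only [coeff_X_mul_ncSeries_pow]
  rw [ncSeries, PowerSeries.coeff_mk, ncSum_range_eq_sum_markedSum r hn]

theorem constantCoeff_ncSeries (r : ℕ → R) :
    PowerSeries.constantCoeff (ncSeries r) = 1 := by
  rw [← PowerSeries.coeff_zero_eq_constantCoeff_apply, ncSeries, PowerSeries.coeff_mk,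
    Finset.range_zero, ncSum_empty]

/-! ### Substitution of `z M(z)` -/

theorem hasSubst_X_mul (M : PowerSeries R) : PowerSeries.HasSubst (PowerSeries.X * M) :=
  PowerSeries.HasSubst.of_constantCoeff_zero' (by simp)

theorem coeff_X_mul_pow_of_lt (M : PowerSeries R) {n k : ℕ} (h : n < k) :
    PowerSeries.coeff n ((PowerSeries.X * M) ^ k) = 0 := by
  rw [mul_pow, PowerSeries.coeff_X_pow_mul', if_neg (not_le.2 h)]

/-- The `k`-th power of `z M` starts at degree `k`, so any bound beyond `n` truncates the sum
without loss. -/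
theorem coeff_subst_X_mul (M F : PowerSeries R) {n N : ℕ} (h : n < N) :
    PowerSeries.coeff n (F.subst (PowerSeries.X * M)) = ∑ k ∈ Finset.range N,
      PowerSeries.coeff k F * PowerSeries.coeff n ((PowerSeries.X * M) ^ k) := by
  rw [PowerSeries.coeff_subst' (hasSubst_X_mul M)]
  simp only [smul_eq_mul]
  refine finsum_eq_sum_of_support_subset _ fun k hk => ?_
  rw [Finset.coe_range, Set.mem_Iio]
  by_contra hN
  exact hk (by simp only [coeff_X_mul_pow_of_lt M (h.trans_le (not_lt.1 hN)), mul_zero])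

theorem coeff_subst_X_mul_mul (M F G : PowerSeries R) {n N : ℕ} (h : n < N) :
    PowerSeries.coeff n (F.subst (PowerSeries.X * M) * G) = ∑ k ∈ Finset.range N,
      PowerSeries.coeff k F * PowerSeries.coeff n ((PowerSeries.X * M) ^ k * G) := by
  simp only [PowerSeries.coeff_mul, Finset.mul_sum]
  rw [Finset.sum_comm]
  refine Finset.sum_congr rfl fun x hx => ?_
  have := Finset.HasAntidiagonal.mem_antidiagonal.1 hx
  rw [coeff_subst_X_mul M F (show x.1 < N by omega), Finset.sum_mul]
  exact Finset.sum_congr rfl fun k _ => mul_assoc _ _ _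

/-! ### The derivative of the moments with respect to the free cumulants -/

/-- The dual number `r + f ε`. -/
def dual (r f : ℕ → ℝ) (k : ℕ) : DualNumber ℝ :=
  TrivSqZeroExt.inl (r k) + TrivSqZeroExt.inr (f k)

theorem fst_dual (r f : ℕ → ℝ) (k : ℕ) : (dual r f k).fst = r k := by simp [dual]

theorem snd_dual (r f : ℕ → ℝ) (k : ℕ) : (dual r f k).snd = f k := by simp [dual]

theorem fst_sum {ι : Type*} (s : Finset ι) (g : ι → DualNumber ℝ) :
    (∑ i ∈ s, g i).fst = ∑ i ∈ s, (g i).fst :=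
  map_sum (TrivSqZeroExt.fstHom ℝ ℝ ℝ) g s

theorem snd_sum {ι : Type*} (s : Finset ι) (g : ι → DualNumber ℝ) :
    (∑ i ∈ s, g i).snd = ∑ i ∈ s, (g i).snd :=
  map_sum (TrivSqZeroExt.sndHom ℝ ℝ) g s

theorem fst_prod {ι : Type*} (s : Finset ι) (g : ι → DualNumber ℝ) :
    (∏ i ∈ s, g i).fst = ∏ i ∈ s, (g i).fst :=
  map_prod (TrivSqZeroExt.fstHom ℝ ℝ ℝ) g s

theorem snd_mul (a b : DualNumber ℝ) : (a * b).snd = a.fst * b.snd + a.snd * b.fst := by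
  simp [TrivSqZeroExt.snd_mul, mul_comm]

/-- Leibniz's rule; it turns the product over blocks into the sum over one distinguished block that
occurs in the infinitesimal moment-cumulant formula. -/
theorem snd_prod {ι : Type*} [DecidableEq ι] (s : Finset ι) (g : ι → DualNumber ℝ) :
    (∏ i ∈ s, g i).snd = ∑ i ∈ s, (g i).snd * ∏ j ∈ s.erase i, (g j).fst := by
  induction s using Finset.induction_on with
  | empty => simp
  | insert a s ha ih =>
    rw [Finset.prod_insert ha, snd_mul, ih, fst_prod, Finset.sum_insert ha,
      Finset.erase_insert ha, add_comm, Finset.mul_sum]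
    congr 1
    refine Finset.sum_congr rfl fun i hi => ?_
    have hia : a ≠ i := fun e => ha (e ▸ hi)
    rw [Finset.erase_insert_of_ne hia, Finset.prod_insert (fun h => ha (Finset.mem_of_mem_erase h))]
    ring

open Classical in
/-- The derivative of `ncSum` at the weights `r` in the direction `f`. -/
noncomputable def ncDeriv {α : Type*} [LinearOrder α] (r f : ℕ → ℝ) (s : Finset α) : ℝ :=
  ∑ P ∈ ncParts s, ∑ V ∈ P, f V.card * ∏ W ∈ P.erase V, r W.card

theorem fst_ncSum_dual {α : Type*} [LinearOrder α] (r f : ℕ → ℝ) (s : Finset α) :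
    (ncSum (dual r f) s).fst = ncSum r s := by
  simp only [ncSum, fst_sum, fst_prod, fst_dual]

/-- The functional equation holds over every commutative ring, hence over the dual numbers; reading
off its second component differentiates it. -/
theorem snd_ncSum_dual {α : Type*} [LinearOrder α] (r f : ℕ → ℝ) (s : Finset α) :
    (ncSum (dual r f) s).snd = ncDeriv r f s := by
  classical
  simp only [ncSum, ncDeriv, snd_sum, snd_prod, snd_dual, fst_dual]

/-- The coefficientwise first component of a power series over the dual numbers. -/
noncomputable def fstSeries (A : PowerSeries (DualNumber ℝ)) : PowerSeries ℝ :=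
  PowerSeries.map (TrivSqZeroExt.fstHom ℝ ℝ ℝ).toRingHom A

/-- The coefficientwise second component of a power series over the dual numbers. -/
noncomputable def sndSeries (A : PowerSeries (DualNumber ℝ)) : PowerSeries ℝ :=
  PowerSeries.mk fun n => (PowerSeries.coeff n A).snd

theorem coeff_fstSeries (A : PowerSeries (DualNumber ℝ)) (n : ℕ) :
    PowerSeries.coeff n (fstSeries A) = (PowerSeries.coeff n A).fst := by
  rw [fstSeries, PowerSeries.coeff_map]; rfl

theorem fstSeries_mul (A B : PowerSeries (DualNumber ℝ)) :
    fstSeries (A * B) = fstSeries A * fstSeries B := map_mul _ _ _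

theorem fstSeries_pow (A : PowerSeries (DualNumber ℝ)) (k : ℕ) :
    fstSeries (A ^ k) = fstSeries A ^ k := map_pow _ _ _

theorem sndSeries_mul (A B : PowerSeries (DualNumber ℝ)) :
    sndSeries (A * B) = fstSeries A * sndSeries B + sndSeries A * fstSeries B := by
  ext n
  rw [map_add, PowerSeries.coeff_mul, PowerSeries.coeff_mul, sndSeries, PowerSeries.coeff_mk,
    PowerSeries.coeff_mul, snd_sum, ← Finset.sum_add_distrib]
  refine Finset.sum_congr rfl fun x _ => ?_
  rw [snd_mul, coeff_fstSeries, coeff_fstSeries, sndSeries, sndSeries, PowerSeries.coeff_mk,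
    PowerSeries.coeff_mk]

theorem sndSeries_one : sndSeries 1 = 0 := by
  ext n
  rw [sndSeries, PowerSeries.coeff_mk, PowerSeries.coeff_one, map_zero]
  split_ifs
  · exact TrivSqZeroExt.snd_one
  · exact TrivSqZeroExt.snd_zero

/-- The truncated exponent `k - 1` at `k = 0` is harmless because the factor `k` vanishes. -/
theorem sndSeries_pow (A : PowerSeries (DualNumber ℝ)) (k : ℕ) :
    sndSeries (A ^ k) = (k : PowerSeries ℝ) * fstSeries A ^ (k - 1) * sndSeries A := by
  induction k with
  | zero => rw [pow_zero, sndSeries_one, Nat.cast_zero, zero_mul, zero_mul]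
  | succ k ih =>
    rw [pow_succ, sndSeries_mul, ih, fstSeries_pow]
    cases k with
    | zero => simp
    | succ k =>
      rw [Nat.add_sub_cancel, Nat.add_sub_cancel]
      push_cast
      ring

/-- The generating function of the derivatives `ncDeriv r f {0, …, n-1}`. -/
noncomputable def ncDerivSeries (r f : ℕ → ℝ) : PowerSeries ℝ :=
  PowerSeries.mk fun n => ncDeriv r f (Finset.range n)

theorem fstSeries_X_mul_ncSeries (r f : ℕ → ℝ) :
    fstSeries (PowerSeries.X * ncSeries (dual r f)) = PowerSeries.X * ncSeries r := by
  rw [fstSeries_mul]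
  congr 1
  · exact PowerSeries.map_X _
  · ext n
    rw [coeff_fstSeries, ncSeries, ncSeries, PowerSeries.coeff_mk, PowerSeries.coeff_mk,
      fst_ncSum_dual]

theorem sndSeries_X_mul_ncSeries (r f : ℕ → ℝ) :
    sndSeries (PowerSeries.X * ncSeries (dual r f)) = PowerSeries.X * ncDerivSeries r f := by
  ext n
  rw [sndSeries, PowerSeries.coeff_mk]
  cases n with
  | zero => simp
  | succ n =>
    rw [PowerSeries.coeff_succ_X_mul, PowerSeries.coeff_succ_X_mul, ncSeries, ncDerivSeries,
      PowerSeries.coeff_mk, PowerSeries.coeff_mk, snd_ncSum_dual]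

theorem constantCoeff_ncDerivSeries (r f : ℕ → ℝ) :
    PowerSeries.constantCoeff (ncDerivSeries r f) = 0 := by
  rw [← PowerSeries.coeff_zero_eq_constantCoeff_apply, ncDerivSeries, PowerSeries.coeff_mk,
    Finset.range_zero, ← snd_ncSum_dual, ncSum_empty, TrivSqZeroExt.snd_one]

/-- The convention `r 0 = 1` absorbs the constant term of `M = 1 + ∑ r_k (z M)^k`. -/
theorem ncSeries_eq_subst (r : ℕ → ℝ) (h0 : r 0 = 1) :
    ncSeries r = (PowerSeries.mk r).subst (PowerSeries.X * ncSeries r) := by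
  ext n
  rw [coeff_subst_X_mul _ _ n.lt_succ_self]
  simp only [PowerSeries.coeff_mk]
  rcases Nat.eq_zero_or_pos n with rfl | hn
  · simp [constantCoeff_ncSeries, h0]
  · exact coeff_ncSeries r hn

/-- The second component of the functional equation for the weights `r + f ε`: the first term
differentiates the weights, the second the powers of `z M`. -/
theorem ncDerivSeries_eq (r f : ℕ → ℝ) (hf : f 0 = 0) :
    ncDerivSeries r f = (PowerSeries.mk f).subst (PowerSeries.X * ncSeries r) +
      (PowerSeries.derivative ℝ (PowerSeries.mk r)).subst (PowerSeries.X * ncSeries r) *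
        (PowerSeries.X * ncDerivSeries r f) := by
  set w := PowerSeries.X * ncSeries r with hw
  ext n
  rcases Nat.eq_zero_or_pos n with rfl | hn
  · rw [map_add, coeff_subst_X_mul _ _ Nat.zero_lt_one]
    simp [constantCoeff_ncDerivSeries, hf]
  · have h := congrArg TrivSqZeroExt.snd (coeff_ncSeries (dual r f) hn)
    have hk : ∀ k : ℕ, (PowerSeries.coeff n ((PowerSeries.X * ncSeries (dual r f)) ^ k)).snd =
        PowerSeries.coeff n ((k : PowerSeries ℝ) * w ^ (k - 1) *
          (PowerSeries.X * ncDerivSeries r f)) := fun k => by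
      rw [← sndSeries_X_mul_ncSeries, hw, ← fstSeries_X_mul_ncSeries r f, ← sndSeries_pow,
        sndSeries, PowerSeries.coeff_mk]
    have hk' : ∀ k : ℕ, (PowerSeries.coeff n ((PowerSeries.X * ncSeries (dual r f)) ^ k)).fst =
        PowerSeries.coeff n (w ^ k) := fun k => by
      rw [← coeff_fstSeries, fstSeries_pow, fstSeries_X_mul_ncSeries]
    rw [snd_sum] at h
    simp only [snd_mul, hk, hk', fst_dual, snd_dual] at h
    rw [ncSeries, PowerSeries.coeff_mk, snd_ncSum_dual, Finset.sum_add_distrib, add_comm] at h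
    rw [show PowerSeries.coeff n (ncDerivSeries r f) = ncDeriv r f (Finset.range n) from
      PowerSeries.coeff_mk _ _, h, map_add, hw,
      coeff_subst_X_mul _ _ n.lt_succ_self, coeff_subst_X_mul_mul _ _ _ n.lt_succ_self]
    simp only [PowerSeries.coeff_mk]
    congr 1
    -- The left sum loses its term `k = 0`, which carries the factor `k`, and the right sum its term
    -- `k = n`, which has order above `n`; the rest agree after a shift.
    rw [Finset.sum_range_succ', Finset.sum_range_succ]
    have hlast : PowerSeries.coeff n ((PowerSeries.X * ncSeries r) ^ n *
        (PowerSeries.X * ncDerivSeries r f)) = 0 := by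
      rw [show (PowerSeries.X * ncSeries r) ^ n * (PowerSeries.X * ncDerivSeries r f) =
        PowerSeries.X ^ (n + 1) * (ncSeries r ^ n * ncDerivSeries r f) by ring,
        PowerSeries.coeff_X_pow_mul', if_neg (by omega)]
    rw [hlast]
    simp only [PowerSeries.coeff_mk, PowerSeries.coeff_derivative, Nat.cast_zero, zero_mul,
      map_zero, mul_zero, add_zero, Nat.add_sub_cancel]
    refine Finset.sum_congr rfl fun k _ => ?_
    have hc : ((k + 1 : ℕ) : PowerSeries ℝ) = PowerSeries.C ((k : ℝ) + 1) := by
      simp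
    rw [hc, mul_assoc (PowerSeries.C _), PowerSeries.coeff_C_mul]
    ring

/-- Let `w = z M`, let `D` be the derivative series, `F` the direction series at `w` and `K` the
derivative of the cumulant series at `w`. Then `D (1 - z K) = F`, and differentiating the functional
equation in `z` gives `w' (1 - z K) = M`. Eliminating `1 - z K` gives `D M = F w'` without any
division. -/
theorem ncDerivSeries_mul_ncSeries (r f : ℕ → ℝ) (h0 : r 0 = 1) (hf : f 0 = 0) :
    ncDerivSeries r f * ncSeries r =
      (PowerSeries.mk f).subst (PowerSeries.X * ncSeries r) *
        PowerSeries.derivative ℝ (PowerSeries.X * ncSeries r) := by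
  have h1 := ncDerivSeries_eq r f hf
  have h2 : PowerSeries.derivative ℝ (ncSeries r) =
      (PowerSeries.derivative ℝ (PowerSeries.mk r)).subst (PowerSeries.X * ncSeries r) *
        PowerSeries.derivative ℝ (PowerSeries.X * ncSeries r) := by
    conv_lhs => rw [ncSeries_eq_subst r h0]
    exact PowerSeries.derivative_subst (hasSubst_X_mul _)
  have h3 : PowerSeries.derivative ℝ (PowerSeries.X * ncSeries r) =
      ncSeries r + PowerSeries.X * PowerSeries.derivative ℝ (ncSeries r) := by
    simp [Derivation.leibniz, add_comm]
  set K := (PowerSeries.derivative ℝ (PowerSeries.mk r)).subst (PowerSeries.X * ncSeries r)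
  set F := (PowerSeries.mk f).subst (PowerSeries.X * ncSeries r)
  set w' := PowerSeries.derivative ℝ (PowerSeries.X * ncSeries r)
  rw [h2] at h3
  linear_combination w' * h1 - ncDerivSeries r f * h3

/-! ### Coefficientwise limits of power series -/

/-- Coefficientwise convergence of a sequence of power series. -/
def CoeffTendsto (F : ℕ → PowerSeries ℝ) (G : PowerSeries ℝ) : Prop :=
  ∀ n, Tendsto (fun d => PowerSeries.coeff n (F d)) atTop (𝓝 (PowerSeries.coeff n G))

namespace CoeffTendsto

variable {F G : ℕ → PowerSeries ℝ} {A B : PowerSeries ℝ}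

theorem const (A : PowerSeries ℝ) : CoeffTendsto (fun _ => A) A := fun _ => tendsto_const_nhds

theorem add (hF : CoeffTendsto F A) (hG : CoeffTendsto G B) :
    CoeffTendsto (fun d => F d + G d) (A + B) := fun n => by
  simpa only [map_add] using (hF n).add (hG n)

theorem sub (hF : CoeffTendsto F A) (hG : CoeffTendsto G B) :
    CoeffTendsto (fun d => F d - G d) (A - B) := fun n => by
  simpa only [map_sub] using (hF n).sub (hG n)

theorem mul (hF : CoeffTendsto F A) (hG : CoeffTendsto G B) :
    CoeffTendsto (fun d => F d * G d) (A * B) := fun n => by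
  simp only [PowerSeries.coeff_mul]
  exact tendsto_finsetSum _ fun x _ => (hF x.1).mul (hG x.2)

theorem C_mul (hF : CoeffTendsto F A) {c : ℕ → ℝ} {a : ℝ} (hc : Tendsto c atTop (𝓝 a)) :
    CoeffTendsto (fun d => PowerSeries.C (c d) * F d) (PowerSeries.C a * A) := fun n => by
  simpa only [PowerSeries.coeff_C_mul] using hc.mul (hF n)

theorem derivative (hF : CoeffTendsto F A) :
    CoeffTendsto (fun d => PowerSeries.derivative ℝ (F d)) (PowerSeries.derivative ℝ A) :=
  fun n => by
    simpa only [PowerSeries.coeff_derivative] using (hF (n + 1)).mul_const _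

/-- Continuous dependence of the solution of `Q' = -P Q`, `Q(0) = 1`, on `P`. -/
theorem of_derivative_eq {P Q : ℕ → PowerSeries ℝ} {N E : PowerSeries ℝ}
    (hQ : ∀ᶠ d in atTop, PowerSeries.derivative ℝ (Q d) = -(P d * Q d))
    (hQ0 : ∀ᶠ d in atTop, PowerSeries.constantCoeff (Q d) = 1) (hP : CoeffTendsto P N)
    (hE : PowerSeries.derivative ℝ E = -(N * E)) (hE0 : PowerSeries.constantCoeff E = 1) :
    CoeffTendsto Q E := by
  -- Each coefficient of `Q` is a fixed polynomial in earlier coefficients of `Q` and coefficients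
  -- of `P`, so limits pass through by induction.
  have key : ∀ {P Q : PowerSeries ℝ}, PowerSeries.derivative ℝ Q = -(P * Q) → ∀ n,
      PowerSeries.coeff (n + 1) Q = -(∑ x ∈ Finset.HasAntidiagonal.antidiagonal n,
        PowerSeries.coeff x.1 P * PowerSeries.coeff x.2 Q) / (n + 1) := by
    intro P Q h n
    have := congrArg (PowerSeries.coeff n) h
    rw [PowerSeries.coeff_derivative, map_neg, PowerSeries.coeff_mul] at this
    rw [← this]
    field_simp
  intro n
  induction n using Nat.strong_induction_on with
  | _ n ih =>
    cases n with
    | zero =>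
      simp only [PowerSeries.coeff_zero_eq_constantCoeff_apply, hE0]
      exact tendsto_const_nhds.congr' (hQ0.mono fun d hd => hd.symm)
    | succ n =>
      rw [key hE]
      refine Tendsto.congr' (hQ.mono fun d hd => (key hd n).symm) ?_
      refine (tendsto_finsetSum _ fun x hx => (hP x.1).mul (ih x.2 ?_)).neg.div_const _
      have := Finset.HasAntidiagonal.mem_antidiagonal.1 hx
      omega

/-- Continuous dependence of the coefficient `D` in `R' = -D R`, `R(0) = 1`, on `R`. -/
theorem of_derivative_eq' {D Q : ℕ → PowerSeries ℝ} {N E : PowerSeries ℝ}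
    (hQ : ∀ᶠ d in atTop, PowerSeries.derivative ℝ (Q d) = -(D d * Q d))
    (hQ0 : ∀ᶠ d in atTop, PowerSeries.constantCoeff (Q d) = 1) (hQE : CoeffTendsto Q E)
    (hE : PowerSeries.derivative ℝ E = -(N * E)) (hE0 : PowerSeries.constantCoeff E = 1) :
    CoeffTendsto D N := by
  -- Because `Q(0) = 1`, the equation can be solved for the `n`-th coefficient of `P` in terms of
  -- the earlier ones.
  have key : ∀ {P Q : PowerSeries ℝ}, PowerSeries.derivative ℝ Q = -(P * Q) →
      PowerSeries.constantCoeff Q = 1 → ∀ n, PowerSeries.coeff n P =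
        -PowerSeries.coeff n (PowerSeries.derivative ℝ Q) - ∑ i ∈ Finset.range n,
          PowerSeries.coeff i P * PowerSeries.coeff (n - i) Q := by
    intro P Q h h0 n
    rw [h, map_neg, PowerSeries.coeff_mul, Finset.Nat.sum_antidiagonal_eq_sum_range_succ_mk,
      Finset.sum_range_succ, Nat.sub_self, PowerSeries.coeff_zero_eq_constantCoeff_apply, h0]
    ring
  intro n
  induction n using Nat.strong_induction_on with
  | _ n ih =>
    rw [key hE hE0]
    refine Tendsto.congr' ((hQ.and hQ0).mono fun d hd => (key hd.1 hd.2 n).symm) ?_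
    exact (hQE.derivative n).neg.sub
      (tendsto_finsetSum _ fun i hi => (ih i (Finset.mem_range.1 hi)).mul (hQE (n - i)))

end CoeffTendsto

/-- The linear differential equation `E' = -N E`, `E(0) = 1`, has a solution. -/
theorem exists_derivative_eq (N : PowerSeries ℝ) : ∃ E : PowerSeries ℝ,
    PowerSeries.derivative ℝ E = -(N * E) ∧ PowerSeries.constantCoeff E = 1 := by
  -- The antiderivative of `-N` without constant term; the solution is `exp(g)`.
  set g : PowerSeries ℝ :=
    PowerSeries.X * PowerSeries.mk fun n => -PowerSeries.coeff n N / (n + 1) with hg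
  have hg' : PowerSeries.derivative ℝ g = -N := by
    ext n
    rw [PowerSeries.coeff_derivative, hg, PowerSeries.coeff_succ_X_mul, PowerSeries.coeff_mk,
      map_neg]
    field_simp
  have hexp : PowerSeries.derivative ℝ (PowerSeries.exp ℝ) = PowerSeries.exp ℝ := by
    ext n
    rw [PowerSeries.coeff_derivative, PowerSeries.coeff_exp, PowerSeries.coeff_exp]
    simp only [one_div, map_inv₀, map_natCast, Nat.factorial_succ]
    push_cast
    field_simp
  refine ⟨(PowerSeries.exp ℝ).subst g, ?_, ?_⟩
  · rw [PowerSeries.derivative_subst (hasSubst_X_mul _), hexp, hg']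
    ring
  · rw [← PowerSeries.coeff_zero_eq_constantCoeff_apply, hg, coeff_subst_X_mul _ _ Nat.zero_lt_one]
    simp

/-- The power series `G k` with `G 0 = 1` and `G (k + 1) = G k (1 + c X P) - c (k G k + X G k')`. -/
noncomputable def derivRatio (c : ℝ) (P : PowerSeries ℝ) : ℕ → PowerSeries ℝ
  | 0 => 1
  | k + 1 => derivRatio c P k * (1 + PowerSeries.C c * (PowerSeries.X * P)) -
      PowerSeries.C c * ((k : PowerSeries ℝ) * derivRatio c P k +
        PowerSeries.X * PowerSeries.derivative ℝ (derivRatio c P k))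

/-- As `c → 0` the correction terms vanish and the recursion degenerates to `G_(k+1) = G_k M`. -/
theorem coeffTendsto_derivRatio {c : ℕ → ℝ} {P : ℕ → PowerSeries ℝ} {M : PowerSeries ℝ}
    (hc : Tendsto c atTop (𝓝 0))
    (hM : CoeffTendsto (fun d => 1 + PowerSeries.C (c d) * (PowerSeries.X * P d)) M) (k : ℕ) :
    CoeffTendsto (fun d => derivRatio (c d) (P d) k) (M ^ k) := by
  induction k with
  | zero => exact CoeffTendsto.const 1
  | succ k ih =>
    have := (ih.mul hM).sub ((((CoeffTendsto.const (k : PowerSeries ℝ)).mul ih).add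
      ((CoeffTendsto.const PowerSeries.X).mul ih.derivative)).C_mul hc)
    rw [map_zero, zero_mul, sub_zero, ← pow_succ] at this
    exact this

/-- If `aₖ → [z^k] E` and `Gₖ → M^k`, then `∑ₖ aₖ z^k Gₖ → E(z M(z))`. -/
theorem coeffTendsto_sum_derivRatio {a : ℕ → ℕ → ℝ} {G : ℕ → ℕ → PowerSeries ℝ}
    {M E : PowerSeries ℝ} (ha : ∀ k, Tendsto (fun d => a d k) atTop (𝓝 (PowerSeries.coeff k E)))
    (hG : ∀ k, CoeffTendsto (fun d => G d k) (M ^ k)) :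
    CoeffTendsto (fun d => ∑ k ∈ Finset.range (d + 1),
      PowerSeries.C (a d k) * (PowerSeries.X ^ k * G d k)) (E.subst (PowerSeries.X * M)) := by
  intro n
  rw [coeff_subst_X_mul _ _ n.lt_succ_self]
  have hlim : Tendsto (fun d => ∑ k ∈ Finset.range (n + 1),
      a d k * PowerSeries.coeff n (PowerSeries.X ^ k * G d k)) atTop
      (𝓝 (∑ k ∈ Finset.range (n + 1),
        PowerSeries.coeff k E * PowerSeries.coeff n ((PowerSeries.X * M) ^ k))) := by
    refine tendsto_finsetSum _ fun k _ => (ha k).mul ?_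
    rw [mul_pow]
    exact (CoeffTendsto.const _).mul (hG k) n
  -- The factor `z^k` removes all terms with `k > n`, so the growing sum has a fixed number of
  -- relevant terms once `d ≥ n`.
  refine hlim.congr' ?_
  filter_upwards [eventually_ge_atTop n] with d hd
  simp only [map_sum, PowerSeries.coeff_C_mul]
  refine Finset.sum_subset (Finset.range_mono (by omega)) fun k _ hk => ?_
  rw [Finset.mem_range, not_lt] at hk
  rw [PowerSeries.coeff_X_pow_mul', if_neg (by omega), mul_zero]

/-- The limit of the logarithmic derivatives in terms of the derivative of the moments with respect
to the free cumulants. -/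
theorem derivative_subst_ncSeries {r f : ℕ → ℝ} (h0 : r 0 = 1) (hf : f 0 = 0)
    {E : PowerSeries ℝ}
    (hE : PowerSeries.derivative ℝ E = -((PowerSeries.mk fun n => f (n + 1)) * E)) :
    PowerSeries.derivative ℝ (E.subst (PowerSeries.X * ncSeries r)) =
      -((PowerSeries.mk fun n => ncDeriv r f (Finset.range (n + 1))) *
        E.subst (PowerSeries.X * ncSeries r)) := by
  have hs := hasSubst_X_mul (ncSeries r)
  have h := ncDerivSeries_mul_ncSeries r f h0 hf
  have hX : ∀ g : ℕ → ℝ, g 0 = 0 →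
      PowerSeries.mk g = PowerSeries.X * PowerSeries.mk fun n => g (n + 1) := fun g hg => by
    ext n
    cases n with
    | zero => simp [hg]
    | succ n => rw [PowerSeries.coeff_succ_X_mul, PowerSeries.coeff_mk, PowerSeries.coeff_mk]
  have hM0 : ncSeries r ≠ 0 := fun h => by
    have := constantCoeff_ncSeries r
    rw [h] at this
    simp at this
  have hD0 := constantCoeff_ncDerivSeries r f
  rw [ncDerivSeries, ← PowerSeries.coeff_zero_eq_constantCoeff_apply, PowerSeries.coeff_mk] at hD0
  rw [ncDerivSeries, hX _ hD0, hX _ hf, PowerSeries.subst_mul hs, PowerSeries.subst_X hs] at h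
  have h' : (PowerSeries.mk fun n => ncDeriv r f (Finset.range (n + 1))) =
      (PowerSeries.mk fun n => f (n + 1)).subst (PowerSeries.X * ncSeries r) *
        PowerSeries.derivative ℝ (PowerSeries.X * ncSeries r) := by
    -- Both index shifts produce a factor `z`, and `f(w)` produces `w = z M`; the common factor `z
    -- M` is cancelled.
    refine mul_left_cancel₀ (mul_ne_zero PowerSeries.X_ne_zero hM0) ?_
    linear_combination h
  rw [PowerSeries.derivative_subst hs, hE, h', ← PowerSeries.coe_substAlgHom hs, map_neg, map_mul]
  ring

/-! ### Coefficients of the finite-free additive convolution -/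

theorem coeff_addConv {d k : ℕ} (hk : k ≤ d) (p q : ℝ[X]) :
    (addConv d p q).coeff (d - k) = (-1) ^ k * (d.choose k : ℝ) *
      ∑ i ∈ Finset.range (k + 1), (k.choose i : ℝ) * normCoeff d p i * normCoeff d q (k - i) := by
  rw [addConv, finsetSum_coeff, Finset.sum_eq_single k]
  · rw [coeff_C_mul_X_pow, if_pos rfl]
  · intro j hj hjk
    have := Finset.mem_range.1 hj
    rw [coeff_C_mul_X_pow, if_neg (by omega)]
  · intro h
    exact absurd (Finset.mem_range.2 (by omega)) h

theorem natDegree_addConv_le (d : ℕ) (p q : ℝ[X]) : (addConv d p q).natDegree ≤ d := by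
  refine natDegree_sum_le_of_forall_le _ _ fun k _ => ?_
  exact (natDegree_C_mul_X_pow_le _ _).trans (Nat.sub_le _ _)

theorem coeff_addConv_self {d : ℕ} {p q : ℝ[X]} (hp : p.coeff d = 1) (hq : q.coeff d = 1) :
    (addConv d p q).coeff d = 1 := by
  have := coeff_addConv (Nat.zero_le d) p q
  simpa [normCoeff, hp, hq] using this

theorem monic_addConv {d : ℕ} {p q : ℝ[X]} (hp : p.coeff d = 1) (hq : q.coeff d = 1) :
    (addConv d p q).Monic :=
  monic_of_natDegree_le_of_coeff_eq_one d (natDegree_addConv_le d p q) (coeff_addConv_self hp hq)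

theorem natDegree_addConv {d : ℕ} {p q : ℝ[X]} (hp : p.coeff d = 1) (hq : q.coeff d = 1) :
    (addConv d p q).natDegree = d :=
  natDegree_eq_of_le_of_coeff_ne_zero (natDegree_addConv_le d p q)
    (by rw [coeff_addConv_self hp hq]; exact one_ne_zero)

/-- The convolution with `q` is a differential operator with constant coefficients. -/
theorem addConv_eq_sum_hasseDeriv {d : ℕ} {p : ℝ[X]} (q : ℝ[X]) (hp : p.natDegree ≤ d) :
    addConv d p q = ∑ k ∈ Finset.range (d + 1),
      C (q.coeff (d - k) / (d.choose k : ℝ)) * hasseDeriv k p := by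
  ext j
  rcases lt_or_ge d j with hj | hj
  · rw [coeff_eq_zero_of_natDegree_lt ((natDegree_addConv_le d p q).trans_lt hj),
      finsetSum_coeff, Finset.sum_eq_zero]
    intro k _
    rw [coeff_C_mul, hasseDeriv_coeff,
      coeff_eq_zero_of_natDegree_lt (by omega : p.natDegree < j + k), mul_zero, mul_zero]
  · obtain ⟨m, hm, rfl⟩ : ∃ m ≤ d, j = d - m := ⟨d - j, by omega, by omega⟩
    rw [coeff_addConv hm, finsetSum_coeff]
    have hsub : ∑ k ∈ Finset.range (d + 1),
        (C (q.coeff (d - k) / (d.choose k : ℝ)) * hasseDeriv k p).coeff (d - m) =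
        ∑ k ∈ Finset.range (m + 1),
        (C (q.coeff (d - k) / (d.choose k : ℝ)) * hasseDeriv k p).coeff (d - m) := by
      symm
      refine Finset.sum_subset (Finset.range_mono (by omega)) fun k _ hk => ?_
      rw [Finset.mem_range, not_lt] at hk
      rw [coeff_C_mul, hasseDeriv_coeff,
        coeff_eq_zero_of_natDegree_lt (by omega : p.natDegree < d - m + k), mul_zero, mul_zero]
    rw [hsub, Finset.mul_sum]
    -- Reversing the order pairs the index `i` of `p` with the order `m - i` of differentiation; the
    -- terms then agree by the trinomial identity `hch`.
    refine Eq.trans ?_ (Finset.sum_range_reflect _ _)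
    refine Finset.sum_congr rfl fun i hi => ?_
    have hi : i ≤ m := by have := Finset.mem_range.1 hi; omega
    rw [show m + 1 - 1 - i = m - i by omega, coeff_C_mul, hasseDeriv_coeff,
      show d - m + (m - i) = d - i by omega, normCoeff, normCoeff]
    have hc1 : (d.choose i : ℝ) ≠ 0 := by exact_mod_cast (Nat.choose_pos (hi.trans hm)).ne'
    have hc2 : (d.choose (m - i) : ℝ) ≠ 0 := by
      exact_mod_cast (Nat.choose_pos (show m - i ≤ d by omega)).ne'
    have hch : (d.choose m : ℝ) * m.choose i = d.choose i * (d - i).choose (m - i) := by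
      exact_mod_cast Nat.choose_mul hi
    have hsign : ((-1 : ℝ)) ^ m = (-1) ^ i * (-1) ^ (m - i) := by
      rw [← pow_add]; congr 1; omega
    have hs1 : ((-1 : ℝ) ^ i) * (-1) ^ i = 1 := by rw [← mul_pow]; simp
    have hs2 : ((-1 : ℝ) ^ (m - i)) * (-1) ^ (m - i) = 1 := by rw [← mul_pow]; simp
    rw [hsign]
    field_simp
    linear_combination p.coeff (d - i) * q.coeff (d - (m - i)) *
      ((-1 : ℝ) ^ i * (-1) ^ i * ((-1) ^ (m - i) * (-1) ^ (m - i)) * hch +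
      (d.choose i * (d - i).choose (m - i) : ℝ) * (((-1) ^ (m - i) * (-1) ^ (m - i)) * hs1 + hs2))

/-! ### Zeros in a half plane -/

/-- The polynomial `∑ₖ (d choose k) cₖ X^k`. -/
noncomputable def binomPoly (d : ℕ) (c : ℕ → ℂ) : ℂ[X] :=
  ∑ k ∈ Finset.range (d + 1), C ((d.choose k : ℂ) * c k) * X ^ k

theorem coeff_binomPoly (d : ℕ) (c : ℕ → ℂ) (k : ℕ) :
    (binomPoly d c).coeff k = (d.choose k : ℂ) * c k := by
  rw [binomPoly, finsetSum_coeff]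
  simp only [coeff_C_mul_X_pow]
  rw [Finset.sum_ite_eq]
  split_ifs with h
  · rfl
  · rw [Nat.choose_eq_zero_of_lt (by simpa using h), Nat.cast_zero, zero_mul]

theorem natDegree_binomPoly {d : ℕ} {c : ℕ → ℂ} (h : c d ≠ 0) : (binomPoly d c).natDegree = d := by
  refine natDegree_eq_of_le_of_coeff_ne_zero (natDegree_le_iff_coeff_eq_zero.2 fun k hk => ?_) ?_
  · rw [coeff_binomPoly, Nat.choose_eq_zero_of_lt hk, Nat.cast_zero, zero_mul]
  · rw [coeff_binomPoly, Nat.choose_self, Nat.cast_one, one_mul]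
    exact h

/-- The right side is the polar derivative with pole `-b`. In binomially normalized coefficients it
becomes the shift `c_k - b c_(k+1)`, which can be iterated. -/
theorem binomPoly_polar (d : ℕ) (c : ℕ → ℂ) (b : ℂ) :
    ((d + 1 : ℕ) : ℂ[X]) * binomPoly d (fun k => c k - b * c (k + 1)) =
      ((d + 1 : ℕ) : ℂ[X]) * binomPoly (d + 1) c -
        (X + C b) * derivative (binomPoly (d + 1) c) := by
  have hC : ((d + 1 : ℕ) : ℂ[X]) = C (((d + 1 : ℕ) : ℂ)) := by simp
  ext k
  rw [hC, coeff_sub, coeff_C_mul, coeff_C_mul, add_mul, coeff_add, coeff_C_mul, coeff_derivative,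
    coeff_binomPoly, coeff_binomPoly, coeff_binomPoly]
  have h1 : ((d + 1 : ℕ) : ℂ) * d.choose k = (d + 1).choose (k + 1) * ((k + 1 : ℕ) : ℂ) := by
    exact_mod_cast Nat.add_one_mul_choose_eq d k
  cases k with
  | zero =>
    simp only [mul_coeff_zero, coeff_X_zero, zero_mul, Nat.choose_zero_right, Nat.choose_one_right,
      zero_add]
    push_cast
    ring
  | succ k =>
    rw [coeff_X_mul, coeff_derivative, coeff_binomPoly]
    have h2 : ((d + 1).choose (k + 1) : ℂ) = d.choose k + d.choose (k + 1) := by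
      exact_mod_cast Nat.choose_succ_succ d k
    have h3 : ((d + 1 : ℕ) : ℂ) * d.choose k = (d + 1).choose (k + 1) * ((k + 1 : ℕ) : ℂ) := by
      exact_mod_cast Nat.add_one_mul_choose_eq d k
    push_cast at *
    linear_combination (-b * c (k + 1 + 1)) * h1 - c (k + 1) * (d + 1) * h2 - c (k + 1) * h3

theorem sum_im_lt_zero {s : Multiset ℂ} (hs : s ≠ 0) (h : ∀ z ∈ s, z.im < 0) : s.sum.im < 0 := by
  induction s using Multiset.induction_on with
  | empty => exact absurd rfl hs
  | cons a s ih =>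
    rw [Multiset.sum_cons, Complex.add_im]
    have ha := h a (Multiset.mem_cons_self a s)
    rcases eq_or_ne s 0 with rfl | hs'
    · simpa using ha
    · have := ih hs' fun z hz => h z (Multiset.mem_cons_of_mem hz)
      linarith

/-- The key estimate for Laguerre's theorem: if all points of `s` lie in the open lower half plane
and `Im y ≥ 0`, then `∑ (z + b) / (y - z) ≠ 0` for real `b` with `y ≠ -b`. -/
theorem sum_div_ne_zero {s : Multiset ℂ} (hs : s ≠ 0) (h : ∀ z ∈ s, z.im < 0) {y : ℂ}
    (hy : 0 ≤ y.im) (b : ℝ) (hyb : y + b ≠ 0) :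
    (s.map fun z => (z + b) / (y - z)).sum ≠ 0 := by
  intro h0
  have hne : ∀ z ∈ s, 0 < Complex.normSq (y - z) := fun z hz => by
    rw [Complex.normSq_pos]
    intro e
    have := congrArg Complex.im e
    rw [Complex.sub_im, Complex.zero_im] at this
    linarith [h z hz]
  set a : ℂ → ℂ := fun z => (z + b) * ((Complex.normSq (y - z))⁻¹ : ℝ) with ha
  set t : ℂ → ℝ := fun z => Complex.normSq (z + b) * (Complex.normSq (y - z))⁻¹ with ht
  -- Write `1/(y - z)` as its conjugate over `|y - z|²` and split `y - z = (y + b) - (z + b)`: the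
  -- second part contributes the nonnegative real number `t z`.
  have hterm : ∀ z, (z + b) / (y - z) = a z * (starRingEnd ℂ) (y + b) - (t z : ℂ) := fun z => by
    rw [div_eq_mul_inv, Complex.inv_def, ha, ht]
    simp only [Complex.ofReal_mul, ← Complex.mul_conj, map_sub, map_add, Complex.conj_ofReal]
    ring
  have hsum : (s.map a).sum * (starRingEnd ℂ) (y + b) = ((s.map t).sum : ℝ) := by
    rw [Multiset.map_congr rfl fun z _ => hterm z, Multiset.sum_map_sub, Multiset.sum_map_mul_right,
      sub_eq_zero] at h0
    rw [h0, ← Complex.ofRealHom_eq_coe, map_multiset_sum, Multiset.map_map]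
    rfl
  have hA : (s.map a).sum.im < 0 := by
    refine sum_im_lt_zero (by simpa using hs) fun w hw => ?_
    obtain ⟨z, hz, rfl⟩ := Multiset.mem_map.1 hw
    rw [ha]
    simp only
    rw [Complex.im_mul_ofReal, Complex.add_im, Complex.ofReal_im, add_zero]
    exact mul_neg_of_neg_of_pos (h z hz) (inv_pos.2 (hne z hz))
  have hT : 0 ≤ (s.map t).sum := Multiset.sum_nonneg fun w hw => by
    obtain ⟨z, hz, rfl⟩ := Multiset.mem_map.1 hw
    exact mul_nonneg (Complex.normSq_nonneg _) (inv_nonneg.2 (Complex.normSq_nonneg _))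
  -- In `A |y + b|² = T (y + b)` the left side has negative imaginary part, while `T ≥ 0` and `Im y
  -- ≥ 0` make that of the right side nonnegative.
  have h2 : (s.map a).sum * (Complex.normSq (y + b) : ℂ) = ((s.map t).sum : ℝ) * (y + b) := by
    rw [← hsum, ← Complex.mul_conj]
    ring
  have h3 := congrArg Complex.im h2
  rw [Complex.im_mul_ofReal, Complex.im_ofReal_mul, Complex.add_im, Complex.ofReal_im,
    add_zero] at h3
  have h4 : 0 < Complex.normSq (y + b) := Complex.normSq_pos.2 hyb
  nlinarith [mul_neg_of_neg_of_pos hA h4, mul_nonneg hT hy]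

/-- Laguerre's theorem on polar derivatives, for the open lower half plane. -/
theorem binomPoly_roots_im_neg {d : ℕ} {c : ℕ → ℂ} (hc : c (d + 1) ≠ 0)
    (hr : ∀ z ∈ (binomPoly (d + 1) c).roots, z.im < 0) (b : ℝ) :
    c d - b * c (d + 1) ≠ 0 ∧
    ∀ z ∈ (binomPoly d fun k => c k - b * c (k + 1)).roots, z.im < 0 := by
  set f := binomPoly (d + 1) c with hf
  have hdeg : f.natDegree = d + 1 := natDegree_binomPoly hc
  have hsplit : f.Splits := IsAlgClosed.splits f
  have hcard : f.roots.card = d + 1 := by rw [← hsplit.natDegree_eq_card_roots, hdeg]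
  have hne : f.roots ≠ 0 := fun h => by rw [h] at hcard; simp at hcard
  have hd : (d : ℂ) + 1 ≠ 0 := Nat.cast_add_one_ne_zero d
  constructor
  -- A vanishing leading coefficient would force the sum of the roots to be the real number `-(d +
  -- 1) b`, although every root has negative imaginary part.
  · intro h0
    have h1 := hsplit.nextCoeff_eq_neg_sum_roots_mul_leadingCoeff
    rw [nextCoeff_of_natDegree_pos (by omega), leadingCoeff, hdeg, Nat.add_sub_cancel, hf,
      coeff_binomPoly, coeff_binomPoly, ← hf, Nat.choose_self, Nat.choose_succ_self_right] at h1
    have h2 : f.roots.sum = ((-(d + 1) * b : ℝ) : ℂ) := by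
      refine mul_left_cancel₀ hc ?_
      push_cast at h1 ⊢
      linear_combination h1 - (d + 1) * h0
    have h3 := sum_im_lt_zero hne hr
    rw [h2, Complex.ofReal_im] at h3
    exact lt_irrefl _ h3
  · intro y hy
    by_contra hy0
    rw [not_lt] at hy0
    have hg : (binomPoly d fun k => c k - b * c (k + 1)).eval y = 0 := (mem_roots'.1 hy).2
    have h1 := congrArg (eval y) (binomPoly_polar d c b)
    rw [eval_mul, hg, mul_zero, ← hf] at h1
    simp only [eval_sub, eval_mul, eval_natCast, eval_add, eval_X, eval_C] at h1
    have hfy : f.eval y ≠ 0 := fun e => by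
      have : y ∈ f.roots := mem_roots'.2 ⟨fun h => by simp [h] at hdeg, e⟩
      linarith [hr y this]
    have hyb : y + b ≠ 0 := fun e => by
      rw [e, zero_mul, sub_zero] at h1
      push_cast at h1
      exact mul_ne_zero hd hfy h1.symm
    have h2 := hsplit.eval_derivative_div_eval_of_ne_zero hfy
    -- A zero `y` of the polar derivative satisfies `(d + 1) f(y) = (y + b) f'(y)`; dividing by
    -- `f(y)` and using `f'/f = ∑ 1/(y - z)` turns this into the vanishing of `∑ (z + b)/(y - z)`.
    refine sum_div_ne_zero hne hr hy0 b hyb ?_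
    have hterm : ∀ z ∈ f.roots, (z + b) / (y - z) = (y + b) * (1 / (y - z)) - 1 := fun z hz => by
      have : y - z ≠ 0 := sub_ne_zero.2 fun e => by linarith [hr z hz, congrArg Complex.im e]
      field_simp
      ring
    rw [Multiset.map_congr rfl hterm, Multiset.sum_map_sub, Multiset.sum_map_mul_left, ← h2]
    simp only [Multiset.map_const', Multiset.sum_replicate, hcard, nsmul_eq_mul, mul_one]
    field_simp
    linear_combination h1

/-- A case of Grace's theorem. -/
theorem sum_coeff_mul_ne_zero (s : Multiset ℝ) : ∀ c : ℕ → ℂ, c s.card ≠ 0 →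
    (∀ z ∈ (binomPoly s.card c).roots, z.im < 0) →
    ∑ k ∈ Finset.range (s.card + 1),
      (((s.map fun b => X - C b).prod.coeff (s.card - k) : ℝ) : ℂ) * c k ≠ 0 := by
  induction s using Multiset.induction_on with
  | empty => intro c hc _; simpa using hc
  | cons b s ih =>
    intro c hc hr
    rw [Multiset.card_cons] at hc hr
    obtain ⟨h1, h2⟩ := binomPoly_roots_im_neg hc hr b
    have h3 := ih _ h1 h2
    set q := (s.map fun b => X - C b).prod with hq
    have hqd : q.natDegree = s.card := natDegree_multiset_prod_X_sub_C_eq_card s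
    -- Moving the factor `X - b` across the pairing replaces `c_k` by `c_k - b c_(k+1)`, so the
    -- pairings for `b ::ₘ s` and for `s` are equal.
    convert h3 using 1
    rw [Multiset.map_cons, Multiset.prod_cons, ← hq, Multiset.card_cons, Finset.sum_range_succ,
      Nat.sub_self]
    have h4 : ((X - C b) * q).coeff 0 = -b * q.coeff 0 := by simp
    have h5 : ∀ k ∈ Finset.range (s.card + 1),
        (((X - C b) * q).coeff (s.card + 1 - k) : ℂ) * c k =
          q.coeff (s.card - k) * c k - b * (q.coeff (s.card + 1 - k) * c k) := fun k hk => by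
      have := Finset.mem_range.1 hk
      rw [show s.card + 1 - k = (s.card - k) + 1 by omega, sub_mul, coeff_sub, coeff_X_mul,
        coeff_C_mul]
      push_cast
      ring
    rw [Finset.sum_congr rfl h5, Finset.sum_sub_distrib, ← Finset.mul_sum,
      Finset.sum_range_succ' (fun k => (q.coeff (s.card + 1 - k) : ℂ) * c k), h4,
      coeff_eq_zero_of_natDegree_lt (by omega : q.natDegree < s.card + 1 - 0)]
    simp only [mul_sub, Finset.sum_sub_distrib]
    rw [Finset.sum_range_succ (fun k => (q.coeff (s.card - k) : ℂ) * (b * c (k + 1))),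
      Nat.sub_self]
    simp only [Nat.add_sub_add_right]
    have : ∀ k, (q.coeff (s.card - k) : ℂ) * (b * c (k + 1)) =
      b * (q.coeff (s.card - k) * c (k + 1)) := fun k => by ring
    simp only [this, ← Finset.mul_sum]
    push_cast
    ring

/-! ### Real-rootedness -/

/-- Non-real zeros of a real polynomial come in conjugate pairs, so excluding the upper half plane
suffices. -/
theorem splits_of_forall_im_pos {p : ℝ[X]} (h : ∀ z : ℂ, 0 < z.im → aeval z p ≠ 0) : p.Splits := by
  refine Splits.of_splits_map (algebraMap ℝ ℂ) (IsAlgClosed.splits _) fun z hz => ?_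
  have hz0 : aeval z p = 0 := by
    rw [aeval_def, ← eval_map]
    exact (mem_roots'.1 hz).2
  rcases lt_trichotomy z.im 0 with hi | hi | hi
  · refine absurd ?_ (h ((starRingEnd ℂ) z) (by simpa using hi))
    rw [aeval_conj, hz0, map_zero]
  · exact ⟨z.re, Complex.ext (by simp) (by simp [hi])⟩
  · exact absurd hz0 (h z hi)

theorem IsMonicRealRooted.coeff_eq_one {d : ℕ} {p : ℝ[X]} (hp : IsMonicRealRooted d p) :
    p.coeff d = 1 := by
  rw [← hp.natDegree_eq]
  exact hp.monic.coeff_natDegree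

theorem IsMonicRealRooted.card_roots {d : ℕ} {p : ℝ[X]} (hp : IsMonicRealRooted d p) :
    p.roots.card = d := by
  rw [← hp.splits.natDegree_eq_card_roots, hp.natDegree_eq]

theorem IsMonicRealRooted.prod_roots {d : ℕ} {p : ℝ[X]} (hp : IsMonicRealRooted d p) :
    (p.roots.map fun a => X - C a).prod = p :=
  (hp.splits.eq_prod_roots_of_monic hp.monic).symm

/-- The finite-free additive convolution preserves real-rootedness. -/
theorem IsMonicRealRooted.addConv {d : ℕ} {p q : ℝ[X]} (hp : IsMonicRealRooted d p)
    (hq : IsMonicRealRooted d q) : IsMonicRealRooted d (addConv d p q) := by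
  refine ⟨monic_addConv hp.coeff_eq_one hq.coeff_eq_one,
    natDegree_addConv hp.coeff_eq_one hq.coeff_eq_one, splits_of_forall_im_pos fun x hx => ?_⟩
  set P := p.map (algebraMap ℝ ℂ) with hP
  set f := taylor x P with hf
  have hPdeg : P.natDegree = d := by rw [hP, natDegree_map, hp.natDegree_eq]
  have hPmonic : P.Monic := hp.monic.map _
  have hfdeg : f.natDegree = d := by rw [hf, natDegree_taylor, hPdeg]
  have hfc : f.coeff d = 1 := by
    have : f.leadingCoeff = 1 := by rw [hf, leadingCoeff_taylor]; exact hPmonic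
    rwa [leadingCoeff, hfdeg] at this
  set c : ℕ → ℂ := fun k => f.coeff k / (d.choose k : ℂ) with hc
  have hbin : binomPoly d c = f := by
    ext k
    rw [coeff_binomPoly, hc]
    simp only
    rcases le_or_gt k d with hk | hk
    · have : (d.choose k : ℂ) ≠ 0 := by exact_mod_cast (Nat.choose_pos hk).ne'
      field_simp
    · rw [Nat.choose_eq_zero_of_lt hk, coeff_eq_zero_of_natDegree_lt (by omega)]
      simp
  -- The roots of the shifted polynomial are `a - x` with `a` real and `Im x > 0`.
  have hroots : ∀ z ∈ f.roots, z.im < 0 := fun z hz => by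
    have h1 : P.eval (z + x) = 0 := by
      have := (mem_roots'.1 hz).2
      rwa [IsRoot, hf, taylor_eval] at this
    have h2 : z + x ∈ P.roots := mem_roots'.2 ⟨hPmonic.ne_zero, h1⟩
    rw [hP, hp.splits.roots_map] at h2
    obtain ⟨a, -, ha⟩ := Multiset.mem_map.1 h2
    have := congrArg Complex.im ha
    simp at this
    linarith
  -- The Taylor coefficients of `p` at `x` are its Hasse derivatives there, so this pairing with the
  -- coefficients of `q` is the value of the convolution at `x`.
  have key := sum_coeff_mul_ne_zero q.roots c (by rw [hq.card_roots, hc]; simp [hfc])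
    (by rw [hq.card_roots, hbin]; exact hroots)
  rw [hq.prod_roots, hq.card_roots] at key
  convert key using 1
  rw [addConv_eq_sum_hasseDeriv q hp.natDegree_eq.le, map_sum]
  refine Finset.sum_congr rfl fun k _ => ?_
  rw [map_mul, aeval_C, hc, hf]
  simp only
  have hmap : hasseDeriv k P = (hasseDeriv k p).map (algebraMap ℝ ℂ) := by
    ext n
    simp [hP, hasseDeriv_coeff]
  rw [taylor_coeff, hmap, eval_map_algebraMap, map_div₀, map_natCast]
  simp only [Complex.coe_algebraMap]
  ring

/-! ### Reversed polynomials as power series -/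

/-- The reversed polynomial `x^d p(1/x)`, as a power series. -/
noncomputable def revSeries (d : ℕ) (p : ℝ[X]) : PowerSeries ℝ :=
  PowerSeries.mk fun n => if n ≤ d then p.coeff (d - n) else 0

theorem coeff_revSeries (d : ℕ) (p : ℝ[X]) (n : ℕ) :
    PowerSeries.coeff n (revSeries d p) = if n ≤ d then p.coeff (d - n) else 0 :=
  PowerSeries.coeff_mk _ _

theorem constantCoeff_revSeries (d : ℕ) (p : ℝ[X]) :
    PowerSeries.constantCoeff (revSeries d p) = p.coeff d := by
  rw [← PowerSeries.coeff_zero_eq_constantCoeff_apply, coeff_revSeries]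
  simp

theorem revSeries_C_mul (d : ℕ) (a : ℝ) (p : ℝ[X]) :
    revSeries d (C a * p) = PowerSeries.C a * revSeries d p := by
  ext n
  simp only [PowerSeries.coeff_C_mul, coeff_revSeries, coeff_C_mul, mul_ite, mul_zero]

theorem revSeries_sum {ι : Type*} (s : Finset ι) (d : ℕ) (p : ι → ℝ[X]) :
    revSeries d (∑ i ∈ s, p i) = ∑ i ∈ s, revSeries d (p i) := by
  ext n
  simp only [map_sum, coeff_revSeries]
  split_ifs
  · rw [finsetSum_coeff]
  · simp

theorem revSeries_X_sub_C_mul {d : ℕ} {p : ℝ[X]} (hp : p.natDegree ≤ d) (b : ℝ) :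
    revSeries (d + 1) ((X - C b) * p) = (1 - PowerSeries.C b * PowerSeries.X) * revSeries d p := by
  ext n
  rw [sub_mul, sub_mul, one_mul, map_sub, coeff_revSeries, mul_assoc, PowerSeries.coeff_C_mul]
  cases n with
  | zero =>
    simp only [PowerSeries.coeff_zero_X_mul, coeff_revSeries, Nat.zero_le, if_true, Nat.sub_zero,
      coeff_sub, coeff_X_mul, coeff_C_mul]
    rw [coeff_eq_zero_of_natDegree_lt (by omega : p.natDegree < d + 1)]
  | succ n =>
    rw [PowerSeries.coeff_succ_X_mul, coeff_revSeries, coeff_revSeries, coeff_sub, coeff_C_mul]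
    rcases lt_trichotomy n d with h | rfl | h
    · rw [if_pos (by omega), if_pos (by omega), if_pos (by omega),
        show d + 1 - (n + 1) = d - (n + 1) + 1 by omega, coeff_X_mul,
        show d - n = d - (n + 1) + 1 by omega]
    · simp
    · rw [if_neg (by omega), if_neg (by omega), if_neg (by omega)]
      simp

theorem X_pow_mul_revSeries {d k : ℕ} (hk : k ≤ d) {p : ℝ[X]} (hp : p.natDegree ≤ d - k) :
    PowerSeries.X ^ k * revSeries (d - k) p = revSeries d p := by
  ext n
  rw [PowerSeries.coeff_X_pow_mul', coeff_revSeries, coeff_revSeries]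
  by_cases hkn : k ≤ n
  · rw [if_pos hkn]
    by_cases hn : n ≤ d
    · rw [if_pos (by omega), if_pos hn, show d - k - (n - k) = d - n by omega]
    · rw [if_neg (by omega), if_neg hn]
  · rw [if_neg hkn, if_pos (by omega), coeff_eq_zero_of_natDegree_lt (by omega)]

/-- Euler's relation. -/
theorem revSeries_derivative (e : ℕ) (p : ℝ[X]) :
    revSeries e (derivative p) = PowerSeries.C ((e : ℝ) + 1) * revSeries (e + 1) p -
      PowerSeries.X * PowerSeries.derivative ℝ (revSeries (e + 1) p) := by
  ext n
  have hX : PowerSeries.coeff n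
      (PowerSeries.X * PowerSeries.derivative ℝ (revSeries (e + 1) p)) =
      n * PowerSeries.coeff n (revSeries (e + 1) p) := by
    cases n with
    | zero => simp
    | succ n =>
      rw [PowerSeries.coeff_succ_X_mul, PowerSeries.coeff_derivative]
      push_cast
      ring
  rw [map_sub, PowerSeries.coeff_C_mul, hX, coeff_revSeries, coeff_revSeries]
  rcases lt_trichotomy n (e + 1) with h | rfl | h
  · rw [if_pos (by omega), if_pos (by omega), coeff_derivative,
      show e + 1 - n = e - n + 1 by omega, Nat.cast_sub (by omega)]
    ring
  · simp
  · rw [if_neg (by omega), if_neg (by omega)]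
    ring

/-- The generating function of the power sums `∑ₐ a^(n+1)` over a multiset. -/
noncomputable def powerSumSeries (s : Multiset ℝ) : PowerSeries ℝ :=
  PowerSeries.mk fun n => (s.map fun a => a ^ (n + 1)).sum

/-- Newton's identities. -/
theorem derivative_revSeries_prod (s : Multiset ℝ) :
    PowerSeries.derivative ℝ (revSeries s.card (s.map fun b => X - C b).prod) =
      -(powerSumSeries s * revSeries s.card (s.map fun b => X - C b).prod) := by
  induction s using Multiset.induction_on with
  | empty =>
    have h1 : powerSumSeries 0 = 0 := by ext n; simp [powerSumSeries]
    have h2 : revSeries 0 1 = 1 := by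
      ext n
      rw [coeff_revSeries, PowerSeries.coeff_one]
      rcases Nat.eq_zero_or_pos n with rfl | hn
      · simp
      · rw [if_neg (by omega), if_neg (by omega)]
    simp [h1, h2]
  | cons b s ih =>
    rw [Multiset.map_cons, Multiset.prod_cons, Multiset.card_cons,
      revSeries_X_sub_C_mul (natDegree_multiset_prod_X_sub_C_eq_card s).le]
    set Q := revSeries s.card (s.map fun b => X - C b).prod
    have h1 : powerSumSeries (b ::ₘ s) = powerSumSeries {b} + powerSumSeries s := by
      ext n; simp [powerSumSeries]
    -- The geometric series: a single root contributes `b / (1 - b z)`.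
    have h2 : (1 - PowerSeries.C b * PowerSeries.X) * powerSumSeries {b} = PowerSeries.C b := by
      ext n
      rw [sub_mul, one_mul, mul_assoc, map_sub, PowerSeries.coeff_C_mul, PowerSeries.coeff_C]
      cases n with
      | zero => simp [powerSumSeries]
      | succ n =>
        rw [PowerSeries.coeff_succ_X_mul]
        simp [powerSumSeries]
        ring
    have h3 : PowerSeries.derivative ℝ (1 - PowerSeries.C b * PowerSeries.X) =
        -PowerSeries.C b := by
      simp [Derivation.leibniz]
    rw [Derivation.leibniz, ih, h3, h1]
    simp only [smul_eq_mul]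
    linear_combination Q * h2

theorem IsMonicRealRooted.derivative_revSeries {d : ℕ} {p : ℝ[X]} (hp : IsMonicRealRooted d p) :
    PowerSeries.derivative ℝ (revSeries d p) = -(powerSumSeries p.roots * revSeries d p) := by
  have := derivative_revSeries_prod p.roots
  rwa [hp.prod_roots, hp.card_roots] at this

/-! ### Reversed derivatives and the reversed convolution -/

/-- Euler's relation sends `V` to `(d - k) V - z V'`. With `V = d^k G_k U` and `U' = -P U`,
extracting `d^(k+1)` leaves the recursion of `derivRatio` with `c = 1/d`. -/
theorem revSeries_iterate_derivative {d : ℕ} (hd : 0 < d) {p : ℝ[X]} {P : PowerSeries ℝ}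
    (hP : PowerSeries.derivative ℝ (revSeries d p) = -(P * revSeries d p)) {k : ℕ} (hk : k ≤ d) :
    revSeries (d - k) (derivative^[k] p) =
      PowerSeries.C ((d : ℝ) ^ k) * derivRatio (1 / d) P k * revSeries d p := by
  induction k with
  | zero => simp [derivRatio]
  | succ k ih =>
    rw [Function.iterate_succ_apply', revSeries_derivative,
      show d - (k + 1) + 1 = d - k by omega, ih (by omega), derivRatio]
    set G := derivRatio (1 / d) P k
    set U := revSeries d p
    have h1 : ((d - (k + 1) : ℕ) : ℝ) + 1 = d - k := by
      rw [Nat.cast_sub hk]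
      push_cast
      ring
    have h2 : (PowerSeries.C ((d : ℝ) ^ (k + 1)) : PowerSeries ℝ) * PowerSeries.C (1 / (d : ℝ)) =
        PowerSeries.C ((d : ℝ) ^ k) := by
      rw [← map_mul]
      congr 1
      have : (d : ℝ) ≠ 0 := by positivity
      field_simp
      ring
    have h3 : (PowerSeries.C ((d : ℝ) ^ (k + 1)) : PowerSeries ℝ) =
        PowerSeries.C ((d : ℝ) ^ k) * PowerSeries.C (d : ℝ) := by
      rw [← map_mul, pow_succ]
    have h4 : ((k : ℕ) : PowerSeries ℝ) = PowerSeries.C (k : ℝ) := by simp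
    rw [h1, map_sub, h4, mul_assoc (PowerSeries.C ((d : ℝ) ^ k)), Derivation.leibniz,
      Derivation.leibniz, hP, PowerSeries.derivative_C]
    simp only [smul_eq_mul]
    linear_combination (-(U * G * (PowerSeries.X * P) - U * (PowerSeries.C (k : ℝ) * G +
      PowerSeries.X * PowerSeries.derivative ℝ G))) * h2 - G * U * h3

/-- The binomial of the normalization and the `k!` of the Hasse derivative combine to the falling
factorial, and its quotient with the `d^k` of the reversed derivative tends to `1`. -/
theorem revSeries_addConv {d : ℕ} (hd : 0 < d) {p : ℝ[X]} (q : ℝ[X]) (hp : p.natDegree ≤ d)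
    {P : PowerSeries ℝ}
    (hP : PowerSeries.derivative ℝ (revSeries d p) = -(P * revSeries d p)) :
    revSeries d (addConv d p q) = (∑ k ∈ Finset.range (d + 1),
      PowerSeries.C (PowerSeries.coeff k (revSeries d q) * ((d : ℝ) ^ k / d.descFactorial k)) *
        (PowerSeries.X ^ k * derivRatio (1 / d) P k)) * revSeries d p := by
  rw [addConv_eq_sum_hasseDeriv q hp, revSeries_sum, Finset.sum_mul]
  refine Finset.sum_congr rfl fun k hk => ?_
  have hk : k ≤ d := by have := Finset.mem_range.1 hk; omega
  have hH : hasseDeriv k p = C ((k.factorial : ℝ)⁻¹) * derivative^[k] p := by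
    rw [← factorial_smul_hasseDeriv, LinearMap.smul_apply, nsmul_eq_mul]
    have : ((k.factorial : ℕ) : ℝ[X]) = C (k.factorial : ℝ) := by simp
    rw [this, ← mul_assoc, ← C_mul,
      inv_mul_cancel₀ (by exact_mod_cast k.factorial_ne_zero), C_1, one_mul]
  have hdeg : (derivative^[k] p).natDegree ≤ d - k :=
    (natDegree_iterate_derivative p k).trans (Nat.sub_le_sub_right hp k)
  rw [revSeries_C_mul, hH, revSeries_C_mul, ← X_pow_mul_revSeries hk hdeg,
    revSeries_iterate_derivative hd hP hk, coeff_revSeries, if_pos hk]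
  have hcst : (PowerSeries.C (q.coeff (d - k) / (d.choose k : ℝ)) : PowerSeries ℝ) *
      (PowerSeries.C (k.factorial : ℝ)⁻¹ * PowerSeries.C ((d : ℝ) ^ k)) =
      PowerSeries.C (q.coeff (d - k) * ((d : ℝ) ^ k / d.descFactorial k)) := by
    rw [← map_mul, ← map_mul, Nat.descFactorial_eq_factorial_mul_choose]
    congr 1
    push_cast
    have h1 : (d.choose k : ℝ) ≠ 0 := by exact_mod_cast (Nat.choose_pos hk).ne'
    have h2 : (k.factorial : ℝ) ≠ 0 := by exact_mod_cast k.factorial_ne_zero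
    field_simp
  linear_combination (PowerSeries.X ^ k * derivRatio (1 / d) P k * revSeries d p) * hcst

theorem tendsto_pow_div_descFactorial (k : ℕ) :
    Tendsto (fun d : ℕ => (d : ℝ) ^ k / d.descFactorial k) atTop (𝓝 1) := by
  have h := (isEquivalent_descFactorial k).symm
  rw [Asymptotics.isEquivalent_iff_tendsto_one] at h
  · exact h
  · filter_upwards [eventually_ge_atTop k] with d hd
    exact_mod_cast (Nat.descFactorial_pos.2 hd).ne'

/-- The asymptotics of the power sums of a finite-free additive convolution: if the normalized power
sums of `p d` converge to moments with free cumulants `r`, and the power sums of `q d` converge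
to `f`, then the difference of the power sums of `p d ⊞ q d` and of `p d` converges to the derivative
of the moments at `r` in the direction `f`. -/
theorem coeffTendsto_powerSumSeries_addConv {p q : ℕ → ℝ[X]} {r f : ℕ → ℝ}
    (hp : ∀ d, 1 ≤ d → IsMonicRealRooted d (p d)) (hq : ∀ d, 1 ≤ d → IsMonicRealRooted d (q d))
    (h0 : r 0 = 1) (hf : f 0 = 0)
    (hpr : CoeffTendsto (fun d => 1 + PowerSeries.C (1 / (d : ℝ)) *
      (PowerSeries.X * powerSumSeries (p d).roots)) (ncSeries r))
    (hqf : CoeffTendsto (fun d => powerSumSeries (q d).roots)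
      (PowerSeries.mk fun n => f (n + 1))) :
    CoeffTendsto (fun d => powerSumSeries (addConv d (p d) (q d)).roots -
      powerSumSeries (p d).roots) (PowerSeries.mk fun n => ncDeriv r f (Finset.range (n + 1))) := by
  obtain ⟨E, hE, hE0⟩ := exists_derivative_eq (PowerSeries.mk fun n => f (n + 1))
  have hpos := eventually_ge_atTop 1
  have hqE : CoeffTendsto (fun d => revSeries d (q d)) E :=
    CoeffTendsto.of_derivative_eq (hpos.mono fun d hd => (hq d hd).derivative_revSeries)
      (hpos.mono fun d hd => by rw [constantCoeff_revSeries, (hq d hd).coeff_eq_one]) hqf hE hE0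
  set R : ℕ → PowerSeries ℝ := fun d => ∑ k ∈ Finset.range (d + 1),
    PowerSeries.C (PowerSeries.coeff k (revSeries d (q d)) * ((d : ℝ) ^ k / d.descFactorial k)) *
      (PowerSeries.X ^ k * derivRatio (1 / d) (powerSumSeries (p d).roots) k) with hR
  have hRE : CoeffTendsto R (E.subst (PowerSeries.X * ncSeries r)) := by
    refine coeffTendsto_sum_derivRatio (fun k => ?_)
      (fun k => coeffTendsto_derivRatio tendsto_one_div_atTop_nhds_zero_nat hpr k)
    simpa using (hqE k).mul (tendsto_pow_div_descFactorial k)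
  have hV : ∀ d, 1 ≤ d → revSeries d (addConv d (p d) (q d)) = R d * revSeries d (p d) :=
    fun d hd => revSeries_addConv hd (q d) (hp d hd).natDegree_eq.le (hp d hd).derivative_revSeries
  -- The ratio `R` of the two reversed polynomials satisfies `R' = -D R`, where `D` is the
  -- difference of the power sum series; its limit `E(w)` therefore determines the limit of `D`.
  refine CoeffTendsto.of_derivative_eq' (Q := R) ?_ ?_ hRE (derivative_subst_ncSeries h0 hf hE) ?_
  · filter_upwards [hpos] with d hd
    have h1 := ((hp d hd).addConv (hq d hd)).derivative_revSeries
    have h2 := (hp d hd).derivative_revSeries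
    rw [hV d hd, Derivation.leibniz, h2] at h1
    simp only [smul_eq_mul] at h1
    have hU : revSeries d (p d) ≠ 0 := fun h => by
      have := constantCoeff_revSeries d (p d)
      rw [h, (hp d hd).coeff_eq_one] at this
      simp at this
    refine mul_left_cancel₀ hU ?_
    linear_combination h1
  · filter_upwards [hpos] with d hd
    have h1 := congrArg PowerSeries.constantCoeff (hV d hd)
    rw [map_mul, constantCoeff_revSeries, constantCoeff_revSeries, (hp d hd).coeff_eq_one,
      ((hp d hd).addConv (hq d hd)).coeff_eq_one, mul_one] at h1
    exact h1.symm
  · rw [← PowerSeries.coeff_zero_eq_constantCoeff_apply, coeff_subst_X_mul _ _ Nat.zero_lt_one]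
    simp [hE0]

/-! ### Moments of root distributions -/

theorem integrable_and_integral_sum_dirac (s : Multiset ℝ) (g : ℝ → ℝ) :
    Integrable g (s.map fun a : ℝ => Measure.dirac a).sum ∧
      ∫ t, g t ∂(s.map fun a : ℝ => Measure.dirac a).sum = (s.map g).sum := by
  induction s using Multiset.induction_on with
  | empty => simp
  | cons a s ih =>
    simp only [Multiset.map_cons, Multiset.sum_cons]
    have ha : Integrable g (Measure.dirac a) := integrable_dirac (by simp)
    exact ⟨ha.add_measure ih.1, by rw [integral_add_measure ha ih.1, ih.2, integral_dirac]⟩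

theorem mom_rootDistribution (p : ℝ[X]) (n : ℕ) :
    mom (rootDistribution p) n = (p.natDegree : ℝ)⁻¹ * (p.roots.map fun a => a ^ n).sum := by
  rw [mom, ProbabilityTheory.moment, rootDistribution, integral_smul_measure]
  simp only [Pi.pow_apply]
  rw [(integrable_and_integral_sum_dirac p.roots fun t => t ^ n).2]
  simp

theorem IsMonicRealRooted.mom_eq {d : ℕ} {p : ℝ[X]} (hp : IsMonicRealRooted d p) (n : ℕ) :
    mom (rootDistribution p) (n + 1) = 1 / d * PowerSeries.coeff n (powerSumSeries p.roots) := by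
  rw [mom_rootDistribution, hp.natDegree_eq, powerSumSeries, PowerSeries.coeff_mk, one_div]

theorem IsMonicRealRooted.mom_zero {d : ℕ} (hd : 1 ≤ d) {p : ℝ[X]} (hp : IsMonicRealRooted d p) :
    mom (rootDistribution p) 0 = 1 := by
  have : (d : ℝ) ≠ 0 := by positivity
  rw [mom_rootDistribution, hp.natDegree_eq]
  simp [hp.card_roots, this]

theorem IsLawWithMoments.mom_zero {μ : Measure ℝ} (h : IsLawWithMoments μ) : mom μ 0 = 1 := by
  have := h.isProb
  simp [mom, ProbabilityTheory.moment]

theorem mom_dirac_zero (n : ℕ) : mom (Measure.dirac 0) (n + 1) = 0 := by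
  simp [mom, ProbabilityTheory.moment]

/-! ### Cumulants -/

/-- The free cumulants, with the value `1` at `0`. -/
noncomputable def cum (m : ℕ → ℝ) (n : ℕ) : ℝ := if n = 0 then 1 else freeCumulant m n

/-- The infinitesimal free cumulants, with the value `0` at `0`. -/
noncomputable def infCum (m m' : ℕ → ℝ) (n : ℕ) : ℝ := if n = 0 then 0 else infFreeCumulant m m' n

theorem ncDeriv_univ_fin (r f : ℕ → ℝ) (n : ℕ) :
    ncDeriv r f (Finset.univ : Finset (Fin n)) = ncDeriv r f (Finset.range n) := by
  rw [← snd_ncSum_dual, ncSum_univ_fin, snd_ncSum_dual]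

theorem card_ne_zero_of_mem_parts {n : ℕ} {π : Finpartition (Finset.univ : Finset (Fin n))}
    {V : Finset (Fin n)} (hV : V ∈ π.parts) : V.card ≠ 0 :=
  Finset.card_ne_zero.2 (π.nonempty_of_mem_parts hV)

theorem moment_eq_ncSum (m : ℕ → ℝ) {n : ℕ} (hn : 1 ≤ n) :
    m n = ncSum (cum m) (Finset.range n) := by
  rw [← ncSum_univ_fin, ncSum,
    ← sum_NC_eq_sum_ncParts (fun P => ∏ V ∈ P, cum m V.card), moment_cumulant m hn]
  refine Finset.sum_congr rfl fun π _ => Finset.prod_congr rfl fun V hV => ?_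
  rw [cum, if_neg (card_ne_zero_of_mem_parts hV)]

theorem ncDeriv_cum_eq_sum_NC (m f : ℕ → ℝ) (n : ℕ) [DecidableEq (Finset (Fin n))] :
    ncDeriv (cum m) f (Finset.range n) = ∑ π ∈ NC n, ∑ V ∈ π.parts,
      f V.card * ∏ W ∈ π.parts.erase V, freeCumulant m W.card := by
  classical
  rw [← ncDeriv_univ_fin, ncDeriv]
  refine (sum_NC_eq_sum_ncParts _).symm.trans ?_
  refine Finset.sum_congr rfl fun π _ => Finset.sum_congr rfl fun V hV => ?_
  congr 1
  refine Finset.prod_congr (by congr!) fun W hW => ?_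
  rw [cum, if_neg (card_ne_zero_of_mem_parts (Finset.mem_of_mem_erase hW))]

theorem inf_moment_eq_ncDeriv (m m' : ℕ → ℝ) {n : ℕ} (hn : 1 ≤ n) :
    m' n = ncDeriv (cum m) (infCum m m') (Finset.range n) := by
  classical
  rw [ncDeriv_cum_eq_sum_NC, inf_moment_cumulant m m' hn]
  refine Finset.sum_congr rfl fun π _ => Finset.sum_congr rfl fun V hV => ?_
  rw [infCum, if_neg (card_ne_zero_of_mem_parts hV)]

theorem ncDeriv_add (r f g : ℕ → ℝ) {α : Type*} [LinearOrder α] (s : Finset α) :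
    ncDeriv r (fun n => f n + g n) s = ncDeriv r f s + ncDeriv r g s := by
  simp only [ncDeriv, add_mul, Finset.sum_add_distrib]

/-- The relation is triangular: the one-block partition contributes the `n`-th value with
coefficient one, and all other partitions involve only smaller blocks. -/
theorem infFreeCumulant_eq_of_moment (m m' h : ℕ → ℝ)
    (hm : ∀ n, 1 ≤ n → m' n = ncDeriv (cum m) h (Finset.range n)) :
    ∀ n, 1 ≤ n → infFreeCumulant m m' n = h n := by
  classical
  intro n
  induction n using Nat.strong_induction_on with
  | _ n ih =>
    intro hn
    have h1 := inf_moment_cumulant m m' hn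
    have h2 := hm n hn
    rw [ncDeriv_cum_eq_sum_NC] at h2
    rw [sum_NC hn (fun P => ∑ V ∈ P, infFreeCumulant m m' V.card *
      ∏ W ∈ P.erase V, freeCumulant m W.card)] at h1
    rw [sum_NC hn (fun P => ∑ V ∈ P, h V.card * ∏ W ∈ P.erase V, freeCumulant m W.card)] at h2
    have h3 : ∑ π ∈ properNC n, ∑ V ∈ π.parts, infFreeCumulant m m' V.card *
        ∏ W ∈ π.parts.erase V, freeCumulant m W.card = ∑ π ∈ properNC n, ∑ V ∈ π.parts,
        h V.card * ∏ W ∈ π.parts.erase V, freeCumulant m W.card :=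
      Finset.sum_congr rfl fun π hπ => Finset.sum_congr rfl fun V hV => by
        rw [ih _ (card_lt_of_mem_properNC hπ hV)
          (Nat.one_le_iff_ne_zero.2 (card_ne_zero_of_mem_parts hV))]
    simp only [Finset.sum_singleton, Finset.card_univ, Fintype.card_fin, Finset.erase_singleton,
      Finset.prod_empty, mul_one] at h1 h2
    linarith

theorem ncSeries_cum (m : ℕ → ℝ) (h0 : m 0 = 1) : ncSeries (cum m) = PowerSeries.mk m := by
  ext n
  rw [PowerSeries.coeff_mk]
  rcases Nat.eq_zero_or_pos n with rfl | hn
  · rw [PowerSeries.coeff_zero_eq_constantCoeff_apply, constantCoeff_ncSeries, h0]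
  · rw [ncSeries, PowerSeries.coeff_mk, ← moment_eq_ncSum m hn]

theorem cum_zero (m : ℕ → ℝ) : cum m 0 = 1 := if_pos rfl

theorem infCum_zero (m m' : ℕ → ℝ) : infCum m m' 0 = 0 := if_pos rfl

theorem ncSeries_cum_eq_one {m : ℕ → ℝ} (h0 : m 0 = 1) (hm : ∀ n, m (n + 1) = 0) :
    ncSeries (cum m) = 1 := by
  rw [ncSeries_cum m h0]
  ext n
  cases n with
  | zero => simp [h0]
  | succ n => rw [PowerSeries.coeff_mk, PowerSeries.coeff_one, hm, if_neg n.succ_ne_zero]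

/-- The free cumulants of `δ₀` vanish. -/
theorem freeCumulant_eq_zero {m : ℕ → ℝ} (h0 : m 0 = 1) (hm : ∀ n, m (n + 1) = 0) {n : ℕ}
    (hn : 1 ≤ n) : freeCumulant m n = 0 := by
  have h := ncSeries_eq_subst (cum m) (cum_zero m)
  -- With `M = 1` the functional equation says that the cumulant series itself equals `1`.
  rw [ncSeries_cum_eq_one h0 hm, mul_one, PowerSeries.X_subst] at h
  have := congrArg (PowerSeries.coeff n) h
  rw [PowerSeries.coeff_mk, PowerSeries.coeff_one, if_neg (by omega), cum, if_neg (by omega)] at this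
  exact this.symm

/-- The infinitesimal free cumulants of `(δ₀, m')` are the infinitesimal moments. -/
theorem infFreeCumulant_eq_self {m : ℕ → ℝ} (h0 : m 0 = 1) (hm : ∀ n, m (n + 1) = 0) (m' : ℕ → ℝ)
    {n : ℕ} (hn : 1 ≤ n) : infFreeCumulant m m' n = m' n := by
  have h := ncDerivSeries_mul_ncSeries (cum m) (infCum m m') (cum_zero m) (infCum_zero m m')
  -- With `M = 1` and `w = z`, the identity `D M = F(w) w'` reduces to `D = F`.
  rw [ncSeries_cum_eq_one h0 hm, mul_one, mul_one, PowerSeries.X_subst, PowerSeries.derivative_X,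
    mul_one] at h
  have := congrArg (PowerSeries.coeff n) h
  rw [ncDerivSeries, PowerSeries.coeff_mk, PowerSeries.coeff_mk, ← inf_moment_eq_ncDeriv m m' hn,
    infCum, if_neg (by omega)] at this
  exact this.symm

/-! ### Convolution with infinitesimal perturbations of `δ₀` -/

/-- Adding the zero cumulants of `δ₀` leaves `μ` unchanged, so only the functional has to be
constructed; it is prescribed on monomials by the moment formula for the summed infinitesimal
cumulants. -/
theorem exists_isInfFreeAddConv {μ : Measure ℝ} (hμ : IsLawWithMoments μ) (μ' ν' : ℝ[X] →ₗ[ℝ] ℝ)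
    (hν : IsLawWithMoments (Measure.dirac 0)) :
    ∃ γ', IsInfFreeAddConv μ μ' (Measure.dirac 0) ν' μ γ' := by
  set h : ℕ → ℝ := fun n => infCumulant μ μ' n + infCumulant (Measure.dirac 0) ν' n
  set g : ℕ → ℝ := fun n => if n = 0 then 0 else ncDeriv (cum (mom μ)) h (Finset.range n) with hg
  set γ' : ℝ[X] →ₗ[ℝ] ℝ := (basisMonomials ℝ).constr ℝ g with hγ'
  have hX : ∀ n, γ' (X ^ n) = g n := fun n => by
    rw [hγ', ← monomial_one_right_eq_X_pow, ← congrFun (coe_basisMonomials ℝ) n, Module.Basis.constr_basis]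
  refine ⟨γ', ⟨hμ, fun n hn => ?_⟩, ?_, fun n hn => ?_⟩
  · rw [freeCumulant_eq_zero hν.mom_zero mom_dirac_zero hn, add_zero]
  · rw [← pow_zero X, hX, hg]
    simp
  · refine infFreeCumulant_eq_of_moment (mom μ) _ h (fun n hn => ?_) n hn
    rw [hX, hg]
    simp only
    rw [if_neg (by omega)]

/-- The moments of `γ` are those of `μ`, and by linearity of `ncDeriv` in the direction, `γ'`
exceeds `μ'` by the derivative of the moments in the direction of the infinitesimal moments of `q`.
This is the limit found for the difference of power sums. -/
theorem hasInfinitesimalDistribution_addConv {p q : ℕ → ℝ[X]} {μ γ : Measure ℝ}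
    {μ' ν' γ' : ℝ[X] →ₗ[ℝ] ℝ} (hp : HasInfinitesimalDistribution p μ μ')
    (hq : HasInfinitesimalDistribution q (Measure.dirac 0) ν')
    (hγ : IsInfFreeAddConv μ μ' (Measure.dirac 0) ν' γ γ') :
    HasInfinitesimalDistribution (fun d => addConv d (p d) (q d)) γ γ' := by
  have hpr := hp.limiting.realRooted
  have hqr := hq.limiting.realRooted
  have hν0 := hq.limiting.law.mom_zero
  have hpos := eventually_ge_atTop 1
  set f : ℕ → ℝ := infCum (mom (Measure.dirac 0)) (fun k => ν' (X ^ k)) with hf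
  have hfn : ∀ n, f (n + 1) = ν' (X ^ (n + 1)) := fun n => by
    rw [hf, infCum, if_neg n.succ_ne_zero,
      infFreeCumulant_eq_self hν0 mom_dirac_zero _ (Nat.succ_pos n)]
  have hcum : cum (mom γ) = cum (mom μ) := by
    ext n
    rw [cum, cum]
    split_ifs with hn
    · rfl
    · rw [hγ.freeAddConv.cumulant_add n (by omega),
        freeCumulant_eq_zero hν0 mom_dirac_zero (by omega), add_zero]
  have hmom : mom γ = mom μ := by
    ext n
    rcases Nat.eq_zero_or_pos n with rfl | hn
    · rw [hγ.freeAddConv.law.mom_zero, hp.limiting.law.mom_zero]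
    · rw [moment_eq_ncSum (mom γ) hn, moment_eq_ncSum (mom μ) hn, hcum]
  have hinf : infCum (mom γ) (fun k => γ' (X ^ k)) =
      fun n => infCum (mom μ) (fun k => μ' (X ^ k)) n + f n := by
    ext n
    rw [hf, infCum, infCum, infCum]
    split_ifs with hn
    · rw [add_zero]
    · exact hγ.cumulant_add n (by omega)
  have hγn : ∀ n, γ' (X ^ (n + 1)) = μ' (X ^ (n + 1)) +
      ncDeriv (cum (mom μ)) f (Finset.range (n + 1)) := fun n => by
    rw [inf_moment_eq_ncDeriv (mom γ) (fun k => γ' (X ^ k)) n.succ_pos, hcum, hinf, ncDeriv_add,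
      ← inf_moment_eq_ncDeriv (mom μ) (fun k => μ' (X ^ k)) n.succ_pos]
  have hlim := coeffTendsto_powerSumSeries_addConv (r := cum (mom μ)) (f := f) hpr hqr
    (cum_zero _) (infCum_zero _ _) ?_ ?_
  · have hrr : ∀ d, 1 ≤ d → IsMonicRealRooted d (addConv d (p d) (q d)) :=
      fun d hd => (hpr d hd).addConv (hqr d hd)
    have hder : ∀ n, Tendsto (fun d : ℕ => (d : ℝ) *
        (mom (rootDistribution (addConv d (p d) (q d))) n - mom γ n)) atTop (𝓝 (γ' (X ^ n))) := by
      intro n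
      rw [hmom]
      cases n with
      | zero =>
        rw [pow_zero, hγ.map_one]
        refine tendsto_const_nhds.congr' ?_
        filter_upwards [hpos] with d hd
        rw [(hrr d hd).mom_zero hd, hp.limiting.law.mom_zero, sub_self, mul_zero]
      | succ n =>
        have h1 := hlim n
        rw [PowerSeries.coeff_mk] at h1
        rw [hγn]
        refine ((hp.tendsto (n + 1)).add h1).congr' ?_
        filter_upwards [hpos] with d hd
        have hd0 : (d : ℝ) ≠ 0 := by positivity
        rw [(hrr d hd).mom_eq, (hpr d hd).mom_eq, map_sub]
        field_simp
        ring
    refine ⟨⟨hrr, hγ.freeAddConv.law, fun n => ?_⟩, hder⟩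
    -- Convergence of the moments follows from the infinitesimal limit on multiplying by `1/d → 0`.
    have h1 := (tendsto_one_div_atTop_nhds_zero_nat (𝕜 := ℝ)).mul (hder n)
    rw [zero_mul] at h1
    have h2 := h1.add_const (mom γ n)
    rw [zero_add] at h2
    refine h2.congr' ?_
    filter_upwards [hpos] with d hd
    have hd0 : (d : ℝ) ≠ 0 := by positivity
    field_simp
    ring
  · rw [ncSeries_cum _ hp.limiting.law.mom_zero]
    intro n
    rw [PowerSeries.coeff_mk]
    cases n with
    | zero => simp [hp.limiting.law.mom_zero]
    | succ n =>
      refine (hp.limiting.tendsto (n + 1)).congr' ?_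
      filter_upwards [hpos] with d hd
      rw [(hpr d hd).mom_eq, map_add, PowerSeries.coeff_C_mul, PowerSeries.coeff_succ_X_mul,
        PowerSeries.coeff_one, if_neg n.succ_ne_zero, zero_add]
  · intro n
    rw [PowerSeries.coeff_mk, hfn]
    refine (hq.tendsto (n + 1)).congr' ?_
    filter_upwards [hpos] with d hd
    have hd0 : (d : ℝ) ≠ 0 := by positivity
    rw [(hqr d hd).mom_eq, mom_dirac_zero]
    field_simp
    ring

end FiniteFree

theorem mainTheorem10 (p q : ℕ → ℝ[X]) (μ ν : Measure ℝ) (μ' ν' : ℝ[X] →ₗ[ℝ] ℝ)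
    (hp : FiniteFree.HasInfinitesimalDistribution p μ μ')
    (hq : FiniteFree.HasInfinitesimalDistribution q ν ν')
    (hν : ν = Measure.dirac 0) :
    (∃ (γ : Measure ℝ) (γ' : ℝ[X] →ₗ[ℝ] ℝ), FiniteFree.IsInfFreeAddConv μ μ' ν ν' γ γ') ∧
    ∀ (γ : Measure ℝ) (γ' : ℝ[X] →ₗ[ℝ] ℝ), FiniteFree.IsInfFreeAddConv μ μ' ν ν' γ γ' →
      FiniteFree.HasInfinitesimalDistribution
        (fun d => FiniteFree.addConv d (p d) (q d)) γ γ' := by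
  subst hν
  exact ⟨⟨μ, FiniteFree.exists_isInfFreeAddConv hp.limiting.law μ' ν' hq.limiting.law⟩,
    fun γ γ' hγ => FiniteFree.hasInfinitesimalDistribution_addConv hp hq hγ⟩
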